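/- Let $\mathcal P^2(\mathbb R^d)$ be the space of Borel probability measures on $\mathbb R^d$ with finite second moment, endowed with the second Wasserstein distance $W_2$. Let $U$ be a nonempty compact metric space and let $f:\mathbb R^d\times\mathcal P^2(\mathbb R^d)\times U\to\mathbb R^d$ be continuous and such that, for some $L>0$, $$\|f(x_1,m_1,u)-f(x_2,m_2,u)\|\le L\big(\|x_1-x_2\|+W_2(m_1,m_2)\big)$$ for all $x_1,x_2\in\mathbb R^d$, $m_1,m_2\in\mathcal P^2(\mathbb R^d)$, $u\in U$. Let $M\subset\mathcal P^2(\mathbb R^d)$ be closed and $G=\mathcal P^2(\mathbb R^d)\setminus M$. Write $L^2(m)=L^2(\mathbb R^d,m;\mathbb R^d)$, with inner product $\langle\cdot,\cdot\rangle_m$, and for $m\in\mathcal P^2(\mathbb R^d)$, $s\in L^2(m)$ put $$H(m,s)=\inf_{u\in U}\int_{\mathbb R^d}\langle s(x),f(x,m,u)\rangle\,m(dx).$$ Consider the Dirichlet problem $$H(m,D\varphi(m))+1-\varphi(m)=0\quad (m\in G),\qquad \varphi(m)=0\quad (m\in\partial G).\tag{D}$$ The subdifferential $\partial^-\psi(m)$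 of a real function $\psi$ defined near $m$ is the set of all $s\in L^2(m)$ such that, for every $F\in L^2(m)$, $$\psi\big((\mathrm{Id}+hF)\sharp m\big)-\psi(m)\ \ge\ h\langle s,F\rangle_m+o(h)\qquad(h\downarrow0);$$ the superdifferential $\partial^+\psi(m)$ is defined with $\le$ in place of $\ge$. In the Hadamard form of these notions, the condition is instead that, for every $F\in L^2(m)$, $$\langle s,F\rangle_m\ \le\ \liminf_{h\downarrow0,\ \|F'-F\|_{L^2(m)}=O(h)}\frac{\psi((\mathrm{Id}+hF')\sharp m)-\psi(m)}{h}$$ for the subdifferential, respectively $\langle s,F\rangle_m\ge\limsup$ of the same quotient for the superdifferential. A viscosity supersolution of (D) is a bounded lower semicontinuous $\varphi_1:\operatorname{cl}G\to\mathbb R$ with $\varphi_1=0$ on $\partial G$ and $H(m,s)+1-\varphi_1(m)\le0$ for all $m\in G$, $s\in\partial^-\varphi_1(m)$. A viscosity subsolution of (D) is a bounded upper semicontinuous $\varphi_2:\operatorname{cl}G\to\mathbb R$ with $\varphi_2=0$ on $\partial G$, continuous at every point of $\partial G$, and with $H(m,s)+1-\varphi_2(m)\ge0$ for all $m\in G$,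 $s\in\partial^+\varphi_2(m)$. A viscosity solution of (D) is a viscosity supersolution $\varphi$ for which there is a sequence of viscosity subsolutions $\varphi_k$ with $\varphi_k(m)\to\varphi(m)$ for every $m\in G$. **Theorem.** With either form of the sub- and superdifferentials (the same one throughout), the following hold. 1. (Comparison principle.) If $\varphi_1:\operatorname{cl}G\to[0,1]$ is a viscosity supersolution of (D) and $\varphi_2:\operatorname{cl}G\to[0,1]$ is a viscosity subsolution of (D), then $\varphi_2(m)\le\varphi_1(m)$ for every $m\in\operatorname{cl}G$. 2. (Uniqueness.) The Dirichlet problem (D) has at most one viscosity solution $\varphi:\operatorname{cl}G\to\mathbb R$. -/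

import Mathlib

open MeasureTheory Set Filter Topology
open scoped ENNReal

noncomputable section

namespace WassersteinHJ

/-- `ℝ^d` with the Euclidean norm. -/
abbrev E (d : ℕ) := EuclideanSpace ℝ (Fin d)

/-- `𝒫²(ℝ^d)`: Borel probability measures on `ℝ^d` with finite second moment. -/
@[ext]
structure P2 (d : ℕ) where
  toMeasure : Measure (E d)
  isProb : IsProbabilityMeasure toMeasure
  memLp_id : MemLp (fun x : E d => x) 2 toMeasure

instance P2.instIsProbabilityMeasure {d : ℕ} (m : P2 d) : IsProbabilityMeasure m.toMeasure :=
  m.isProb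

/-- `π` is a transport plan between `m₁` and `m₂`. -/
def IsPlan {d : ℕ} (m₁ m₂ : P2 d) (π : Measure (E d × E d)) : Prop :=
  π.map Prod.fst = m₁.toMeasure ∧ π.map Prod.snd = m₂.toMeasure

/-- The second Wasserstein distance. -/
def W2 {d : ℕ} (m₁ m₂ : P2 d) : ℝ :=
  Real.sqrt (⨅ (π : Measure (E d × E d)) (_ : IsPlan m₁ m₂ π),
    ∫⁻ z, edist z.1 z.2 ^ 2 ∂π).toReal

/-- The topology on `𝒫²(ℝ^d)` is that of the distance `W2`: a set is open iff it contains a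
`W2`-ball around each of its points. -/
instance P2.instTopologicalSpace (d : ℕ) : TopologicalSpace (P2 d) where
  IsOpen s := ∀ m ∈ s, ∃ r : ℝ, 0 < r ∧ ∀ m' : P2 d, W2 m m' < r → m' ∈ s
  isOpen_univ := fun _ _ => ⟨1, one_pos, fun _ _ => mem_univ _⟩
  isOpen_inter := by
    rintro s t hs ht m ⟨hms, hmt⟩
    obtain ⟨r₁, h₁, H₁⟩ := hs m hms
    obtain ⟨r₂, h₂, H₂⟩ := ht m hmt
    exact ⟨min r₁ r₂, lt_min h₁ h₂, fun m' hm' =>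
      ⟨H₁ m' (hm'.trans_le (min_le_left _ _)), H₂ m' (hm'.trans_le (min_le_right _ _))⟩⟩
  isOpen_sUnion := by
    rintro S hS m ⟨s, hsS, hms⟩
    obtain ⟨r, hr, H⟩ := hS s hsS m hms
    exact ⟨r, hr, fun m' hm' => ⟨s, hsS, H m' hm'⟩⟩

/-- The push-forward `(Id + h F) ♯ m`, for `F ∈ L²(m)`. -/
def P2.displace {d : ℕ} (m : P2 d) (F : E d → E d) (hF : MemLp F 2 m.toMeasure) (h : ℝ) :
    P2 d where
  toMeasure := m.toMeasure.map (fun x => x + h • F x)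
  isProb := Measure.isProbabilityMeasure_map
    (m.memLp_id.add (hF.const_smul h)).aestronglyMeasurable.aemeasurable
  memLp_id := by
    have hG : MemLp (fun x => x + h • F x) 2 m.toMeasure := m.memLp_id.add (hF.const_smul h)
    exact (memLp_map_measure_iff aestronglyMeasurable_id
      hG.aestronglyMeasurable.aemeasurable).2 hG

/-- The inner product `⟨s, F⟩_m` of `L²(m)`. -/
def pairing {d : ℕ} (m : P2 d) (s F : E d → E d) : ℝ :=
  ∫ x, inner ℝ (s x) (F x) ∂m.toMeasure

/-- The Hamiltonian `H(m, s) = inf_u ∫ ⟨s(x), f(x, m, u)⟩ m(dx)`. -/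
def hamiltonian {d : ℕ} {U : Type*} (f : E d → P2 d → U → E d) (m : P2 d) (s : E d → E d) : ℝ :=
  ⨅ u : U, pairing m s (fun x => f x m u)

/-- The two forms of sub- and superdifferentials: along the rays `h ↦ (Id + h F) ♯ m`, or
through Hadamard directional derivatives, where the direction may vary with `h`. -/
inductive DiffKind where
  | radial
  | hadamard

/-- The subdifferential `∂⁻ψ(m)`.
* `radial`: `ψ((Id + hF) ♯ m) - ψ(m) ≥ h ⟨s, F⟩_m + o(h)` as `h ↓ 0`, for every `F ∈ L²(m)`.
* `hadamard`: `⟨s, F⟩_m` is at most the lower limit of `(ψ((Id + hF') ♯ m) - ψ(m)) / h` as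
  `h ↓ 0` and `‖F' - F‖_{L²(m)} = O(h)`, for every `F ∈ L²(m)`. -/
def subdifferential {d : ℕ} (κ : DiffKind) (ψ : P2 d → ℝ) (m : P2 d) : Set (E d → E d) :=
  match κ with
  | .radial => {s | MemLp s 2 m.toMeasure ∧
      ∀ (F : E d → E d) (hF : MemLp F 2 m.toMeasure), ∀ ε : ℝ, 0 < ε →
        ∀ᶠ h : ℝ in 𝓝[>] 0,
          h * pairing m s F - ε * h ≤ ψ (m.displace F hF h) - ψ m}
  | .hadamard => {s | MemLp s 2 m.toMeasure ∧
      ∀ F : E d → E d, MemLp F 2 m.toMeasure → ∀ C : ℝ, ∀ ε : ℝ, 0 < ε →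
        ∀ᶠ h : ℝ in 𝓝[>] 0, ∀ (F' : E d → E d) (hF' : MemLp F' 2 m.toMeasure),
          eLpNorm (F' - F) 2 m.toMeasure ≤ ENNReal.ofReal (C * h) →
          h * pairing m s F - ε * h ≤ ψ (m.displace F' hF' h) - ψ m}

/-- The superdifferential `∂⁺ψ(m)`, with the inequalities of `subdifferential` reversed. -/
def superdifferential {d : ℕ} (κ : DiffKind) (ψ : P2 d → ℝ) (m : P2 d) : Set (E d → E d) :=
  match κ with
  | .radial => {s | MemLp s 2 m.toMeasure ∧
      ∀ (F : E d → E d) (hF : MemLp F 2 m.toMeasure), ∀ ε : ℝ, 0 < ε →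
        ∀ᶠ h : ℝ in 𝓝[>] 0,
          ψ (m.displace F hF h) - ψ m ≤ h * pairing m s F + ε * h}
  | .hadamard => {s | MemLp s 2 m.toMeasure ∧
      ∀ F : E d → E d, MemLp F 2 m.toMeasure → ∀ C : ℝ, ∀ ε : ℝ, 0 < ε →
        ∀ᶠ h : ℝ in 𝓝[>] 0, ∀ (F' : E d → E d) (hF' : MemLp F' 2 m.toMeasure),
          eLpNorm (F' - F) 2 m.toMeasure ≤ ENNReal.ofReal (C * h) →
          ψ (m.displace F' hF' h) - ψ m ≤ h * pairing m s F + ε * h}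

/-- Viscosity supersolutions of `H(m, Dφ(m)) + 1 - φ(m) = 0` in `G`, `φ = 0` on `∂G`.
A function on `cl G` is given by a function on the whole space of which only the values on
`cl G` matter: `G` is open in the applications, so the sub- and superdifferentials at points of
`G` do not depend on the values outside `G`. -/
structure IsViscositySupersolution {d : ℕ} {U : Type*} (κ : DiffKind)
    (f : E d → P2 d → U → E d) (G : Set (P2 d)) (φ : P2 d → ℝ) : Prop where
  bounded : ∃ C : ℝ, ∀ m ∈ closure G, |φ m| ≤ C
  lsc : LowerSemicontinuousOn φ (closure G)
  boundary : ∀ m ∈ frontier G, φ m = 0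
  ineq : ∀ m ∈ G, ∀ s ∈ subdifferential κ φ m, hamiltonian f m s + 1 - φ m ≤ 0

/-- Viscosity subsolutions of the Dirichlet problem; they are required to be continuous, as
functions on `cl G`, at the points of `∂G`. -/
structure IsViscositySubsolution {d : ℕ} {U : Type*} (κ : DiffKind)
    (f : E d → P2 d → U → E d) (G : Set (P2 d)) (φ : P2 d → ℝ) : Prop where
  bounded : ∃ C : ℝ, ∀ m ∈ closure G, |φ m| ≤ C
  usc : UpperSemicontinuousOn φ (closure G)
  boundary : ∀ m ∈ frontier G, φ m = 0
  continuous_boundary : ∀ m ∈ frontier G, ContinuousWithinAt φ (closure G) m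
  ineq : ∀ m ∈ G, ∀ s ∈ superdifferential κ φ m, 0 ≤ hamiltonian f m s + 1 - φ m

/-- Viscosity solutions of the Dirichlet problem: supersolutions that are, on `G`, pointwise
limits of a sequence of subsolutions. -/
structure IsViscositySolution {d : ℕ} {U : Type*} (κ : DiffKind)
    (f : E d → P2 d → U → E d) (G : Set (P2 d)) (φ : P2 d → ℝ) : Prop where
  supersolution : IsViscositySupersolution κ f G φ
  approx : ∃ φs : ℕ → P2 d → ℝ, (∀ k, IsViscositySubsolution κ f G (φs k)) ∧
    ∀ m ∈ G, Tendsto (fun k => φs k m) atTop (𝓝 (φ m))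

end WassersteinHJ

end

open WassersteinHJ

/-!
Lifting to `L²` turns a function of measures into a function `X ↦ φ (law X)` on a Hilbert space.
A proximal slope `p` of the lift at `X` descends to the element `𝔼[p | X]` of the sub- or
superdifferential at `law X`, so it is enough to compare functions on a Hilbert space which satisfy
the two Hamilton–Jacobi inequalities for proximal slopes.

There the variables are doubled, with a penalty `θ log (η + ‖x - y‖² + ‖x - k‖²)`: its slopes
multiply `‖x - y‖` at a rate at most `θ / ‖x - y‖`, so the Lipschitz error in the Hamiltonian is of
order `θ`, uniformly in `η`. The infimum of a lower semicontinuous function over a bounded set is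
not attained in infinite dimension, and points near `∂G` at a small mutual distance need not have a
common limit. Hence the third variable `k`, which runs over the points reached by Euler polygons of
the control system in a bounded time. They lie in a compact set, near which the maximizers are
trapped, and `k` can follow the dynamics at no cost. Maximizers are replaced by almost-maximizers up
to a quadratic perturbation, given by the Borwein–Preiss variational principle.
-/

namespace WassersteinHJ

section VariationalPrinciple

lemma exists_forall_le_add_of_bddAbove {X : Type*} {S : Set X} {γ : X → ℝ}
    (hγ : BddAbove (γ '' S)) {w : X} (hw : w ∈ S) {η : ℝ} (hη : 0 < η) :
    ∃ w' ∈ S, γ w ≤ γ w' ∧ ∀ z ∈ S, γ z ≤ γ w' + η := by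
  obtain ⟨_, ⟨v, hv, rfl⟩, hlt⟩ :=
    exists_lt_of_lt_csSup ⟨_, mem_image_of_mem γ hw⟩ (sub_lt_self (sSup (γ '' S)) hη)
  have hsup : ∀ z ∈ S, γ z ≤ sSup (γ '' S) := fun z hz => le_csSup hγ (mem_image_of_mem γ hz)
  rcases le_total (γ w) (γ v) with h | h
  · exact ⟨v, hv, h, fun z hz => by linarith [hsup z hz]⟩
  · exact ⟨w, hw, le_rfl, fun z hz => by linarith [hsup z hz]⟩

variable {X : Type*} [PseudoMetricSpace X] {S : Set X} {g : X → ℝ} {z₀ : X}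

lemma exists_seq_almost_max_penalized (hb : BddAbove (g '' S)) (hz₀ : z₀ ∈ S) {c η : ℕ → ℝ}
    (hc : ∀ n, 0 ≤ c n) (hη : ∀ n, 0 < η n) :
    ∃ (γ : ℕ → X → ℝ) (w : ℕ → X), γ 0 = g ∧
      (∀ n z, γ (n + 1) z = γ n z - c n * dist z (w n) ^ 2) ∧
      (∀ n, w n ∈ S) ∧ g z₀ ≤ g (w 0) ∧ (∀ n, γ n (w n) ≤ γ (n + 1) (w (n + 1))) ∧
      ∀ n, ∀ z ∈ S, γ n z ≤ γ n (w n) + η n := by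
  let State := {p : (X → ℝ) × X // BddAbove (p.1 '' S) ∧ p.2 ∈ S}
  obtain ⟨w₀, hw₀, hle₀, hmax₀⟩ := exists_forall_le_add_of_bddAbove hb hz₀ (hη 0)
  have hstep (n : ℕ) (p : State) : ∃ p' : State,
      (∀ z, p'.1.1 z = p.1.1 z - c n * dist z p.1.2 ^ 2) ∧ p.1.1 p.1.2 ≤ p'.1.1 p'.1.2 ∧
      ∀ z ∈ S, p'.1.1 z ≤ p'.1.1 p'.1.2 + η (n + 1) := by
    obtain ⟨⟨γ, w⟩, ⟨C, hC⟩, hw⟩ := p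
    let γ' : X → ℝ := fun z => γ z - c n * dist z w ^ 2
    have hγ' : BddAbove (γ' '' S) := by
      refine ⟨C, forall_mem_image.2 fun z hz => ?_⟩
      have := hC (mem_image_of_mem γ hz)
      have := mul_nonneg (hc n) (sq_nonneg (dist z w))
      simp only [γ']
      linarith
    obtain ⟨w', hw', hle, hmax⟩ := exists_forall_le_add_of_bddAbove hγ' hw (hη (n + 1))
    refine ⟨⟨⟨γ', w'⟩, hγ', hw'⟩, fun z => rfl, ?_, hmax⟩
    simpa [γ'] using hle
  choose next hnext using hstep
  let p : ℕ → State := fun n => Nat.rec ⟨⟨g, w₀⟩, hb, hw₀⟩ next n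
  refine ⟨fun n => (p n).1.1, fun n => (p n).1.2, rfl, fun n => (hnext n (p n)).1,
    fun n => (p n).2.2, hle₀, fun n => (hnext n (p n)).2.1, fun n => ?_⟩
  cases n with
  | zero => exact hmax₀
  | succ n => exact (hnext n (p n)).2.2

lemma exists_tendsto_almost_max_penalized [CompleteSpace X] (hb : BddAbove (g '' S))
    (hz₀ : z₀ ∈ S) {ε : ℝ} (hε : 0 < ε) :
    ∃ (c η : ℕ → ℝ) (w : ℕ → X) (z : X), (∀ n, 0 ≤ c n) ∧ HasSum c ε ∧ Tendsto η atTop (𝓝 0) ∧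
      (∀ n, 0 ≤ η n) ∧ (∀ n, w n ∈ S) ∧ Tendsto w atTop (𝓝 z) ∧ (∀ n, dist z (w n) ≤ 2) ∧
      (∀ n, g z₀ ≤ g (w n) - ∑ i ∈ Finset.range n, c i * dist (w n) (w i) ^ 2) ∧
      ∀ n, ∀ x ∈ S, g x - ∑ i ∈ Finset.range n, c i * dist x (w i) ^ 2 ≤
        g (w n) - ∑ i ∈ Finset.range n, c i * dist (w n) (w i) ^ 2 + η n := by
  let c : ℕ → ℝ := fun n => ε / 2 * (1 / 2) ^ n
  let η : ℕ → ℝ := fun n => c n * ((1 / 2) ^ n) ^ 2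
  have hc (n : ℕ) : 0 < c n := by positivity
  have hη : Tendsto η atTop (𝓝 0) := by
    have h : Tendsto (fun n : ℕ => ((1 : ℝ) / 2) ^ n) atTop (𝓝 0) :=
      tendsto_pow_atTop_nhds_zero_of_lt_one (by norm_num) (by norm_num)
    simpa [η, c] using (h.const_mul (ε / 2)).mul (h.pow 2)
  obtain ⟨γ, w, hγ₀, hγ, hwS, hw₀, hmono, hmax⟩ :=
    exists_seq_almost_max_penalized hb hz₀ (fun n => (hc n).le) (fun n => (by positivity : 0 < η n))
  have hγ_eq (n : ℕ) (x : X) : γ n x = g x - ∑ i ∈ Finset.range n, c i * dist x (w i) ^ 2 := by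
    induction n with
    | zero => simp [hγ₀]
    | succ n ih => rw [hγ, ih, Finset.sum_range_succ]; ring
  have hdist (n : ℕ) : dist (w n) (w (n + 1)) ≤ 1 * (1 / 2) ^ n := by
    rw [dist_comm, one_mul]
    refine le_of_sq_le_sq (le_of_mul_le_mul_left ?_ (hc n)) (by positivity)
    linarith [hmono n, hγ n (w (n + 1)), hmax n _ (hwS (n + 1))]
  obtain ⟨z, hz⟩ := cauchySeq_tendsto_of_complete
    (cauchySeq_of_le_geometric (1 / 2) 1 (by norm_num) hdist)
  refine ⟨c, η, w, z, fun n => (hc n).le, by simpa [c] using hasSum_geometric_two.mul_left (ε / 2),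
    hη, fun n => by positivity, hwS, hz, fun n => ?_, fun n => ?_, fun n x hx => ?_⟩
  · have h := dist_le_of_le_geometric_of_tendsto (1 / 2) 1 (by norm_num) hdist hz n
    rw [dist_comm]
    refine h.trans ((div_le_iff₀ (by norm_num)).2 ?_)
    linarith [pow_le_one₀ (n := n) (by norm_num : (0 : ℝ) ≤ 1 / 2) (by norm_num)]
  · rw [← hγ_eq]
    have hmono' : Monotone fun n => γ n (w n) := monotone_nat_of_le_succ hmono
    exact hw₀.trans (by simpa [hγ₀] using hmono' n.zero_le)
  · simpa only [hγ_eq] using hmax n x hx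

lemma le_sub_tsum_of_le_almost_max (hg : UpperSemicontinuousOn g S) {c η : ℕ → ℝ}
    (hc : ∀ n, 0 ≤ c n) (hη : Tendsto η atTop (𝓝 0)) {w : ℕ → X} (hwS : ∀ n, w n ∈ S) {z : X}
    (hzS : z ∈ S) (hz : Tendsto w atTop (𝓝 z)) {v : ℝ}
    (hv : ∀ n, v ≤ g (w n) - ∑ i ∈ Finset.range n, c i * dist (w n) (w i) ^ 2 + η n) :
    v ≤ g z - ∑' n, c n * dist z (w n) ^ 2 := by
  have hterm (x : X) (n : ℕ) : 0 ≤ c n * dist x (w n) ^ 2 := mul_nonneg (hc n) (sq_nonneg _)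
  refine le_sub_comm.1 (Real.tsum_le_of_sum_range_le (hterm z) fun N => le_sub_comm.1 ?_)
  refine le_of_forall_pos_le_add fun δ hδ => ?_
  have husc : UpperSemicontinuousOn
      (fun x => g x - ∑ i ∈ Finset.range N, c i * dist x (w i) ^ 2) S := by
    have hcont : Continuous fun x => -∑ i ∈ Finset.range N, c i * dist x (w i) ^ 2 := by fun_prop
    simpa only [sub_eq_add_neg] using hg.add (hcont.upperSemicontinuous.upperSemicontinuousOn S)
  have hN : ∀ᶠ n in atTop, g (w n) - ∑ i ∈ Finset.range N, c i * dist (w n) (w i) ^ 2 <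
      g z - ∑ i ∈ Finset.range N, c i * dist z (w i) ^ 2 + δ / 2 :=
    (tendsto_nhdsWithin_iff.2 ⟨hz, .of_forall hwS⟩).eventually
      (upperSemicontinuousOn_iff.1 husc z hzS _ (by linarith))
  obtain ⟨n, hn, hηn, hNn⟩ :=
    (hN.and ((hη.eventually (gt_mem_nhds (half_pos hδ))).and (eventually_ge_atTop N))).exists
  have hle : ∑ i ∈ Finset.range N, c i * dist (w n) (w i) ^ 2 ≤
      ∑ i ∈ Finset.range n, c i * dist (w n) (w i) ^ 2 :=
    Finset.sum_le_sum_of_subset_of_nonneg (Finset.range_subset_range.2 hNn) fun i _ _ => hterm _ i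
  linarith [hv n]

/-- The Borwein–Preiss variational principle. -/
theorem exists_isMaxOn_sub_tsum_mul_sq_dist [CompleteSpace X] (hS : IsClosed S)
    (hg : UpperSemicontinuousOn g S) (hb : BddAbove (g '' S)) (hz₀ : z₀ ∈ S) {ε : ℝ}
    (hε : 0 < ε) :
    ∃ (c : ℕ → ℝ) (w : ℕ → X), (∀ n, 0 ≤ c n) ∧ HasSum c ε ∧ ∃ z ∈ S,
      (∀ n, dist z (w n) ≤ 2) ∧ g z₀ ≤ g z ∧
      IsMaxOn (fun x => g x - ∑' n, c n * dist x (w n) ^ 2) S z := by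
  obtain ⟨c, η, w, z, hc, hcsum, hη, hη₀, hwS, hz, hzw, hw₀, hmax⟩ :=
    exists_tendsto_almost_max_penalized hb hz₀ hε
  have hterm (x : X) (n : ℕ) : 0 ≤ c n * dist x (w n) ^ 2 := mul_nonneg (hc n) (sq_nonneg _)
  have hsummable (x : X) : Summable fun n => c n * dist x (w n) ^ 2 := by
    refine .of_nonneg_of_le (hterm x) (fun n => ?_) (hcsum.summable.mul_right ((dist x z + 2) ^ 2))
    have := hzw n
    gcongr
    · exact hc n
    · linarith [dist_triangle x z (w n)]
  have hzS : z ∈ S := hS.mem_of_tendsto hz (.of_forall hwS)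
  refine ⟨c, w, hc, hcsum, z, hzS, hzw, ?_, fun x hx => ?_⟩
  · have h := le_sub_tsum_of_le_almost_max hg hc hη hwS hzS hz fun n =>
      (hw₀ n).trans (le_add_of_nonneg_right (hη₀ n))
    exact h.trans (sub_le_self _ (tsum_nonneg (hterm z)))
  · refine le_sub_tsum_of_le_almost_max hg hc hη hwS hzS hz fun n => le_trans ?_ (hmax n x hx)
    exact sub_le_sub_left ((hsummable x).sum_le_tsum _ fun i _ => hterm x i) _

end VariationalPrinciple

section ProximalCalculus

variable {H : Type*} [NormedAddCommGroup H] [InnerProductSpace ℝ H]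

/-- The proximal superdifferential of `φ` at `x` relative to `S`: the slopes at `x` of the
paraboloids which touch the restriction of `φ` to `S` from above at `x`. -/
def proximalSuperdifferential (φ : H → ℝ) (S : Set H) (x : H) : Set H :=
  {p | ∃ C : ℝ, ∀ y ∈ S, φ y ≤ φ x + inner ℝ p (y - x) + C * ‖y - x‖ ^ 2}

/-- The proximal subdifferential of `φ` at `x` relative to `S`: the slopes at `x` of the
paraboloids which touch the restriction of `φ` to `S` from below at `x`. -/
def proximalSubdifferential (φ : H → ℝ) (S : Set H) (x : H) : Set H :=
  {p | ∃ C : ℝ, ∀ y ∈ S, φ x + inner ℝ p (y - x) - C * ‖y - x‖ ^ 2 ≤ φ y}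

variable {φ ψ : H → ℝ} {S : Set H} {x p q : H}

lemma neg_mem_proximalSubdifferential_neg :
    -p ∈ proximalSubdifferential (fun y => -φ y) S x ↔ p ∈ proximalSuperdifferential φ S x := by
  refine exists_congr fun C => forall₂_congr fun y _ => ?_
  rw [inner_neg_left]
  constructor <;> intro h <;> linarith

lemma add_mem_proximalSuperdifferential (hp : p ∈ proximalSuperdifferential φ S x)
    (hq : q ∈ proximalSuperdifferential ψ S x) :
    p + q ∈ proximalSuperdifferential (fun y => φ y + ψ y) S x := by
  obtain ⟨C, hC⟩ := hp
  obtain ⟨D, hD⟩ := hq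
  refine ⟨C + D, fun y hy => ?_⟩
  rw [inner_add_left]
  linarith [hC y hy, hD y hy]

lemma smul_mem_proximalSuperdifferential_log (hp : p ∈ proximalSuperdifferential φ S x)
    (hφ : ∀ y ∈ S, 0 < φ y) (hx : 0 < φ x) {θ : ℝ} (hθ : 0 ≤ θ) :
    (θ / φ x) • p ∈ proximalSuperdifferential (fun y => θ * Real.log (φ y)) S x := by
  obtain ⟨C, hC⟩ := hp
  refine ⟨θ / φ x * C, fun y hy => ?_⟩
  have hlog : Real.log (φ y) - Real.log (φ x) ≤ φ y / φ x - 1 := by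
    rw [← Real.log_div (hφ y hy).ne' hx.ne']
    exact Real.log_le_sub_one_of_pos (div_pos (hφ y hy) hx)
  calc θ * Real.log (φ y)
      ≤ θ * Real.log (φ x) + θ * (φ y / φ x - 1) := by
        rw [← mul_add]; exact mul_le_mul_of_nonneg_left (by linarith) hθ
    _ = θ * Real.log (φ x) + θ / φ x * (φ y - φ x) := by field_simp
    _ ≤ θ * Real.log (φ x) + θ / φ x * (inner ℝ p (y - x) + C * ‖y - x‖ ^ 2) := by
        gcongr; linarith [hC y hy]
    _ = _ := by rw [real_inner_smul_left]; ring

lemma norm_sub_sq_eq_add_inner_add (x y v : H) :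
    ‖y - v‖ ^ 2 = ‖x - v‖ ^ 2 + inner ℝ ((2 : ℝ) • (x - v)) (y - x) + ‖y - x‖ ^ 2 := by
  rw [← sub_add_sub_cancel' x v y, norm_add_sq_real, real_inner_smul_left]

lemma smul_sub_mem_proximalSuperdifferential_norm_sq (S : Set H) (x v : H) :
    (2 : ℝ) • (x - v) ∈ proximalSuperdifferential (fun y => ‖y - v‖ ^ 2) S x :=
  ⟨1, fun y _ => by simpa only [one_mul] using (norm_sub_sq_eq_add_inner_add x y v).le⟩

lemma inner_nonneg_of_mem_proximalSuperdifferential (hp : p ∈ proximalSuperdifferential φ S x)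
    {v : H} (hv : ∃ᶠ h : ℝ in 𝓝[>] 0, x + h • v ∈ S ∧ φ x ≤ φ (x + h • v)) :
    0 ≤ inner ℝ p v := by
  obtain ⟨C, hC⟩ := hp
  by_contra! hneg
  have hsmall : ∀ᶠ h : ℝ in 𝓝[>] 0, h * (C * ‖v‖ ^ 2) < -inner ℝ p v := by
    have : Tendsto (fun h : ℝ => h * (C * ‖v‖ ^ 2)) (𝓝[>] 0) (𝓝 (0 * (C * ‖v‖ ^ 2))) :=
      (tendsto_nhdsWithin_of_tendsto_nhds tendsto_id).mul_const _
    exact this.eventually (gt_mem_nhds (by linarith))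
  obtain ⟨h, ⟨hS, hle⟩, hlt, (hpos : 0 < h)⟩ :=
    (hv.and_eventually (hsmall.and self_mem_nhdsWithin)).exists
  have hC := hC _ hS
  rw [add_sub_cancel_left, real_inner_smul_right, norm_smul, mul_pow, Real.norm_eq_abs, sq_abs]
    at hC
  nlinarith

lemma eventually_le_sub_of_mem_proximalSubdifferential (hp : p ∈ proximalSubdifferential φ S x)
    (hS : S ∈ 𝓝 x) (v : H) (C : ℝ) {ε : ℝ} (hε : 0 < ε) :
    ∀ᶠ h : ℝ in 𝓝[>] 0, ∀ v' : H, ‖v' - v‖ ≤ C * h →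
      h * inner ℝ p v - ε * h ≤ φ (x + h • v') - φ x := by
  obtain ⟨D, hD⟩ := hp
  obtain ⟨r, hr, hrS⟩ := Metric.mem_nhds_iff.1 hS
  set R : ℝ := ‖v‖ + |C|
  have tendsto_mul (a : ℝ) : Tendsto (fun h : ℝ => h * a) (𝓝[>] 0) (𝓝 0) := by
    simpa using (tendsto_nhdsWithin_of_tendsto_nhds tendsto_id).mul_const (b := a) (x := 𝓝[>] 0)
  filter_upwards [self_mem_nhdsWithin, (tendsto_mul 1).eventually (gt_mem_nhds one_pos),
    (tendsto_mul R).eventually (gt_mem_nhds hr),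
    (tendsto_mul (‖p‖ * C + |D| * R ^ 2)).eventually (gt_mem_nhds hε)]
    with h (hpos : 0 < h) hone hR hrem v' hv'
  have hv'R : ‖v'‖ ≤ R := by
    have : C * h ≤ |C| := (mul_le_mul_of_nonneg_right (le_abs_self C) hpos.le).trans
      (mul_le_of_le_one_right (abs_nonneg C) (by linarith))
    linarith [norm_le_insert' v' v]
  have hball : x + h • v' ∈ S := by
    refine hrS ?_
    rw [mem_ball_iff_norm, add_sub_cancel_left, norm_smul, Real.norm_of_nonneg hpos.le]
    exact (mul_le_mul_of_nonneg_left hv'R hpos.le).trans_lt hR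
  have hslope : inner ℝ p v - ‖p‖ * (C * h) ≤ inner ℝ p v' := by
    have h₁ := (abs_le.1 (abs_real_inner_le_norm p (v' - v))).1
    rw [inner_sub_right] at h₁
    linarith [mul_le_mul_of_nonneg_left hv' (norm_nonneg p)]
  have hcurv : D * (h ^ 2 * ‖v'‖ ^ 2) ≤ |D| * (h ^ 2 * R ^ 2) := by
    have : h ^ 2 * ‖v'‖ ^ 2 ≤ h ^ 2 * R ^ 2 := by gcongr
    exact (mul_le_mul_of_nonneg_right (le_abs_self D) (by positivity)).trans (by gcongr)
  have hbound := hD _ hball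
  rw [add_sub_cancel_left, real_inner_smul_right, norm_smul, mul_pow, Real.norm_eq_abs, sq_abs]
    at hbound
  nlinarith

theorem exists_mem_proximalSuperdifferential [CompleteSpace H] (hS : IsClosed S)
    (hφ : UpperSemicontinuousOn φ S) (hb : BddAbove (φ '' S)) {x₀ : H} (hx₀ : x₀ ∈ S) {μ : ℝ}
    (hμ : 0 < μ) :
    ∃ x ∈ S, φ x₀ ≤ φ x ∧ ∃ p ∈ proximalSuperdifferential φ S x, ‖p‖ ≤ μ := by
  obtain ⟨c, w, hc, hcsum, x, hxS, hxw, hle, hmax⟩ :=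
    exists_isMaxOn_sub_tsum_mul_sq_dist hS hφ hb hx₀ (ε := μ / 4) (by linarith)
  have hp_le (n : ℕ) : ‖(2 * c n) • (x - w n)‖ ≤ 4 * c n := by
    rw [norm_smul, Real.norm_of_nonneg (by linarith [hc n]), ← dist_eq_norm]
    nlinarith [hxw n, hc n]
  have hp : Summable fun n => (2 * c n) • (x - w n) :=
    .of_norm_bounded (hcsum.summable.mul_left 4) hp_le
  refine ⟨x, hxS, hle, ∑' n, (2 * c n) • (x - w n), ⟨μ / 4, fun y hyS => ?_⟩, ?_⟩
  · have hx : Summable fun n => c n * dist x (w n) ^ 2 :=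
      .of_nonneg_of_le (fun n => mul_nonneg (hc n) (sq_nonneg _))
        (fun n => mul_le_mul_of_nonneg_left (pow_le_pow_left₀ dist_nonneg (hxw n) 2) (hc n))
        (hcsum.summable.mul_right (2 ^ 2))
    have hexpand (n : ℕ) : c n * dist y (w n) ^ 2 = c n * dist x (w n) ^ 2 +
        inner ℝ ((2 * c n) • (x - w n)) (y - x) + c n * ‖y - x‖ ^ 2 := by
      rw [dist_eq_norm, dist_eq_norm, norm_sub_sq_eq_add_inner_add x y, real_inner_smul_left,
        real_inner_smul_left]
      ring
    have hy := (hx.hasSum.add (hp.hasSum.mapL (innerSLFlip ℝ (y - x)))).add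
      (hcsum.mul_right (‖y - x‖ ^ 2))
    simp only [innerSLFlip_apply_apply, ← hexpand] at hy
    have hmax_y : φ y - ∑' n, c n * dist y (w n) ^ 2 ≤ φ x - ∑' n, c n * dist x (w n) ^ 2 :=
      hmax hyS
    rw [hy.tsum_eq] at hmax_y
    linarith
  · refine tsum_of_norm_bounded ?_ hp_le
    simpa [mul_div_cancel₀] using hcsum.mul_left 4

section Product

variable {H' : Type*} [NormedAddCommGroup H'] [InnerProductSpace ℝ H'] {T : Set H'}
  {Φ : WithLp 2 (H × H') → ℝ} {z P : WithLp 2 (H × H')}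

lemma fst_mem_proximalSuperdifferential
    (hP : P ∈ proximalSuperdifferential Φ (WithLp.ofLp ⁻¹' S ×ˢ T) z) (hz : z.snd ∈ T) :
    P.fst ∈ proximalSuperdifferential (fun x => Φ (WithLp.toLp 2 (x, z.snd))) S z.fst := by
  obtain ⟨C, hC⟩ := hP
  refine ⟨C, fun x hx => ?_⟩
  change _ ≤ Φ z + inner ℝ P.fst (x - z.fst) + C * ‖x - z.fst‖ ^ 2
  simpa [WithLp.prod_inner_apply, WithLp.prod_norm_sq_eq_of_L2] using
    hC (WithLp.toLp 2 (x, z.snd)) ⟨hx, hz⟩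

lemma snd_mem_proximalSuperdifferential
    (hP : P ∈ proximalSuperdifferential Φ (WithLp.ofLp ⁻¹' S ×ˢ T) z) (hz : z.fst ∈ S) :
    P.snd ∈ proximalSuperdifferential (fun y => Φ (WithLp.toLp 2 (z.fst, y))) T z.snd := by
  obtain ⟨C, hC⟩ := hP
  refine ⟨C, fun y hy => ?_⟩
  change _ ≤ Φ z + inner ℝ P.snd (y - z.snd) + C * ‖y - z.snd‖ ^ 2
  simpa [WithLp.prod_inner_apply, WithLp.prod_norm_sq_eq_of_L2] using
    hC (WithLp.toLp 2 (z.fst, y)) ⟨hz, hy⟩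

end Product

end ProximalCalculus

section Euler

open scoped Pointwise NNReal

/-- `EulerReach F x₀ t k`: the point `k` is reached from `x₀` at time `t` by an explicit Euler
scheme, of arbitrary step sizes, for the control system `x' = F x u`. -/
inductive EulerReach {H U : Type*} [AddCommGroup H] [Module ℝ H] (F : H → U → H) (x₀ : H) :
    ℝ → H → Prop
  | start : EulerReach F x₀ 0 x₀
  | step {t : ℝ} {k : H} (h : ℝ) (u : U) : EulerReach F x₀ t k → 0 ≤ h →
      EulerReach F x₀ (t + h) (k + h • F k u)

lemma totallyBounded_of_forall_subset_thickening {X : Type*} [PseudoMetricSpace X] {S : Set X}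
    (h : ∀ ε > 0, ∃ K, TotallyBounded K ∧ S ⊆ Metric.thickening ε K) : TotallyBounded S := by
  refine Metric.totallyBounded_iff.2 fun ε hε => ?_
  obtain ⟨K, hK, hSK⟩ := h (ε / 2) (half_pos hε)
  obtain ⟨t, ht, hKt⟩ := Metric.totallyBounded_iff.1 hK (ε / 2) (half_pos hε)
  refine ⟨t, ht, fun x hx => ?_⟩
  obtain ⟨y, hy, hxy⟩ := Metric.mem_thickening_iff.1 (hSK hx)
  obtain ⟨z, hz, hyz⟩ := mem_iUnion₂.1 (hKt hy)
  refine mem_iUnion₂.2 ⟨z, hz, ?_⟩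
  rw [Metric.mem_ball] at hyz ⊢
  linarith [dist_triangle x y z]

variable {H U : Type*} [NormedAddCommGroup H]

section NormedSpace

variable [NormedSpace ℝ H] {F : H → U → H} {x₀ k : H} {Λ : ℝ≥0} {c t T : ℝ}

lemma EulerReach.time_nonneg (hr : EulerReach F x₀ t k) : 0 ≤ t := by
  induction hr with
  | start => exact le_rfl
  | step h _ _ hh ih => exact add_nonneg ih hh

lemma EulerReach.norm_sub_le (hc : ∀ u, ‖F x₀ u‖ ≤ c) (hF : ∀ u, LipschitzWith Λ (F · u))
    (hr : EulerReach F x₀ t k) : ‖k - x₀‖ ≤ c * t * Real.exp (Λ * t) := by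
  induction hr with
  | start => simp
  | @step t k h u hr hh ih =>
    have ht := hr.time_nonneg
    have hc₀ : 0 ≤ c := (norm_nonneg _).trans (hc u)
    have hFk : ‖F k u‖ ≤ c + Λ * ‖k - x₀‖ := by
      linarith [norm_le_insert' (F k u) (F x₀ u), hc u, (hF u).norm_sub_le k x₀]
    have hexp : 1 + Λ * h ≤ Real.exp (Λ * h) := by linarith [Real.add_one_le_exp (Λ * h)]
    calc ‖k + h • F k u - x₀‖
        ≤ ‖k - x₀‖ + h * (c + Λ * ‖k - x₀‖) := by
          rw [add_sub_right_comm]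
          refine norm_add_le_of_le le_rfl ?_
          rw [norm_smul, Real.norm_of_nonneg hh]
          gcongr
      _ = ‖k - x₀‖ * (1 + Λ * h) + c * h := by ring
      _ ≤ c * t * Real.exp (Λ * t) * Real.exp (Λ * h) + c * h * Real.exp (Λ * (t + h)) := by
          refine add_le_add (by gcongr) (le_mul_of_one_le_right (by positivity) ?_)
          exact Real.one_le_exp (by positivity)
      _ = c * (t + h) * Real.exp (Λ * (t + h)) := by rw [mul_add (Λ : ℝ), Real.exp_add]; ring

/-- Compact sets containing the Picard iterates, up to time `T`, of all Euler schemes for the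
control system `x' = F x u` started at `x₀`. -/
def picardHull (F : H → U → H) (x₀ : H) (T : ℝ) : ℕ → Set H
  | 0 => {x₀}
  | n + 1 => {x₀} + Icc (0 : ℝ) T • closure (convexHull ℝ (image2 F (picardHull F x₀ T n) univ))

lemma isCompact_picardHull [CompleteSpace H] [TopologicalSpace U] [CompactSpace U]
    (hF : Continuous (Function.uncurry F)) (T : ℝ) (n : ℕ) :
    IsCompact (picardHull F x₀ T n) := by
  induction n with
  | zero => exact isCompact_singleton
  | succ n ih =>
    have hvelocities : IsCompact (image2 F (picardHull F x₀ T n) univ) := by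
      rw [← image_uncurry_prod]
      exact (ih.prod isCompact_univ).image hF
    have hconvexHull := hvelocities.totallyBounded.convexHull.closure.isCompact_of_isClosed
      isClosed_closure
    exact isCompact_singleton.add (isCompact_Icc.smul_set hconvexHull)

lemma mem_picardHull {y : ℕ → H} (ht : t ∈ Icc 0 T) (hy₀ : y 0 = x₀)
    (hy : ∀ n, y (n + 1) ∈ {x₀} + t • convexHull ℝ (image2 F (picardHull F x₀ T n) univ)) :
    ∀ n, y n ∈ picardHull F x₀ T n
  | 0 => hy₀
  | n + 1 => add_subset_add_left
      ((smul_set_subset_smul ht).trans (smul_subset_smul_left subset_closure)) (hy n)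

lemma self_mem_add_zero_smul (x : H) {A : Set H} (hA : A.Nonempty) :
    x ∈ {x} + (0 : ℝ) • convexHull ℝ A := by
  rw [zero_smul_set hA.convexHull, add_zero]
  exact mem_singleton x

lemma image2_picardHull_nonempty [Nonempty U] (hT : 0 ≤ T) (n : ℕ) :
    (image2 F (picardHull F x₀ T n) univ).Nonempty := by
  refine Nonempty.image2 ?_ univ_nonempty
  induction n with
  | zero => exact singleton_nonempty x₀
  | succ n ih =>
    exact (singleton_nonempty x₀).add ((nonempty_Icc.2 hT).smul
      ((ih.image2 univ_nonempty).convexHull.closure))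

lemma EulerReach.exists_picard_iterates [Nonempty U] {M : ℝ}
    (hM : ∀ t k, EulerReach F x₀ t k → t ≤ T → ‖k - x₀‖ ≤ M) (hF : ∀ u, LipschitzWith Λ (F · u))
    (hr : EulerReach F x₀ t k) (ht : t ≤ T) :
    ∃ y : ℕ → H, y 0 = x₀ ∧
      (∀ n, y (n + 1) ∈ {x₀} + t • convexHull ℝ (image2 F (picardHull F x₀ T n) univ)) ∧
      ∀ n, ‖k - y n‖ ≤ M * ((Λ * t) ^ n / n.factorial) := by
  have hM₀ : 0 ≤ M := (norm_nonneg _).trans (hM 0 x₀ .start (hr.time_nonneg.trans ht))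
  induction hr with
  | start =>
    refine ⟨fun _ => x₀, rfl, fun n => self_mem_add_zero_smul x₀ ?_, fun n => ?_⟩
    · exact image2_picardHull_nonempty ht n
    · rw [sub_self, norm_zero, mul_zero]
      positivity
  | @step t k h u hr hh ih =>
    obtain ⟨y, hy₀, hy, hky⟩ := ih (by linarith)
    have ht₀ := hr.time_nonneg
    refine ⟨fun | 0 => x₀ | n + 1 => y (n + 1) + h • F (y n) u, rfl, fun n => ?_, fun n => ?_⟩
    · have hFy : h • F (y n) u ∈ h • convexHull ℝ (image2 F (picardHull F x₀ T n) univ) :=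
        smul_mem_smul_set (subset_convexHull ℝ _
          (mem_image2_of_mem (mem_picardHull ⟨ht₀, by linarith⟩ hy₀ hy n) (mem_univ u)))
      rw [(convex_convexHull ℝ _).add_smul ht₀ hh, ← add_assoc]
      exact add_mem_add (hy n) hFy
    · cases n with
      | zero => simpa using hM _ _ (hr.step h u hh) ht
      | succ n =>
        have hstep : ‖k + h • F k u - (y (n + 1) + h • F (y n) u)‖ ≤
            ‖k - y (n + 1)‖ + h * (Λ * ‖k - y n‖) := by
          rw [add_sub_add_comm, ← smul_sub]
          refine norm_add_le_of_le le_rfl ?_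
          rw [norm_smul, Real.norm_of_nonneg hh]
          exact mul_le_mul_of_nonneg_left ((hF u).norm_sub_le k (y n)) hh
        have hbernoulli : t ^ (n + 1) + (n + 1) * t ^ n * h ≤ (t + h) ^ (n + 1) := by
          simpa using pow_add_mul_le_add_pow ht₀ (by linarith) (n + 1)
        calc _ ≤ M * ((Λ * t) ^ (n + 1) / (n + 1).factorial) +
              h * (Λ * (M * ((Λ * t) ^ n / n.factorial))) := by
              grw [hstep, hky (n + 1), hky n]
          _ = M * Λ ^ (n + 1) / (n + 1).factorial * (t ^ (n + 1) + (n + 1) * t ^ n * h) := by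
              rw [Nat.factorial_succ, Nat.cast_mul, Nat.cast_succ]
              field_simp
              ring
          _ ≤ M * Λ ^ (n + 1) / (n + 1).factorial * (t + h) ^ (n + 1) := by gcongr
          _ = _ := by rw [mul_pow (Λ : ℝ)]; ring

/-- The error `M (Λ T) ^ n / n!` of the `n`-th Picard iterate is uniform over all schemes. -/
lemma totallyBounded_eulerReach [CompleteSpace H] [TopologicalSpace U] [CompactSpace U] [Nonempty U]
    (hF : Continuous (Function.uncurry F)) (hΛ : ∀ u, LipschitzWith Λ (F · u)) (x₀ : H) (T : ℝ) :
    TotallyBounded {k | ∃ t ≤ T, EulerReach F x₀ t k} := by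
  obtain ⟨c, hc⟩ : ∃ c, ∀ u, ‖F x₀ u‖ ≤ c := by
    obtain ⟨c, hc⟩ :=
      (isCompact_range (hF.comp (Continuous.prodMk_right x₀))).isBounded.exists_norm_le
    exact ⟨c, fun u => hc _ (mem_range_self u)⟩
  have hM (t : ℝ) (k : H) (hr : EulerReach F x₀ t k) (ht : t ≤ T) :
      ‖k - x₀‖ ≤ c * T * Real.exp (Λ * T) := by
    have hc₀ : 0 ≤ c := (norm_nonneg _).trans (hc (Classical.arbitrary U))
    have ht₀ := hr.time_nonneg
    refine (hr.norm_sub_le hc hΛ).trans (mul_le_mul (by gcongr) (by gcongr) (by positivity) ?_)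
    exact mul_nonneg hc₀ (ht₀.trans ht)
  have herror : Tendsto (fun n : ℕ => c * T * Real.exp (Λ * T) * ((Λ * T) ^ n / n.factorial))
      atTop (𝓝 0) := by
    simpa using (FloorSemiring.tendsto_pow_div_factorial_atTop (Λ * T : ℝ)).const_mul
      (c * T * Real.exp (Λ * T))
  refine totallyBounded_of_forall_subset_thickening fun ε hε => ?_
  obtain ⟨n, hn⟩ := (herror.eventually (gt_mem_nhds hε)).exists
  refine ⟨picardHull F x₀ T n, (isCompact_picardHull hF T n).totallyBounded, ?_⟩
  rintro k ⟨t, ht, hr⟩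
  obtain ⟨y, hy₀, hy, hky⟩ := hr.exists_picard_iterates hM hΛ ht
  have ht₀ := hr.time_nonneg
  refine Metric.mem_thickening_iff.2 ⟨y n, mem_picardHull ⟨ht₀, ht⟩ hy₀ hy n, ?_⟩
  have hM₀ : 0 ≤ c * T * Real.exp (Λ * T) := (norm_nonneg _).trans (hM t k hr ht)
  rw [dist_eq_norm]
  exact (hky n).trans_lt (lt_of_le_of_lt (by gcongr) hn)

end NormedSpace

section InnerProductSpace

variable [InnerProductSpace ℝ H] {F : H → U → H} {x₀ : H}

/-- The closure of the set of time-space points of the Euler schemes started at `x₀`, in the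
Hilbert space `ℝ × H`. -/
def eulerGraph (F : H → U → H) (x₀ : H) : Set (WithLp 2 (ℝ × H)) :=
  closure {z | EulerReach F x₀ z.fst z.snd}

lemma start_mem_eulerGraph : WithLp.toLp 2 (0, x₀) ∈ eulerGraph F x₀ :=
  subset_closure EulerReach.start

lemma fst_nonneg_of_mem_eulerGraph {z : WithLp 2 (ℝ × H)} (hz : z ∈ eulerGraph F x₀) :
    0 ≤ z.fst :=
  closure_minimal (fun _ hz => EulerReach.time_nonneg hz)
    (isClosed_le continuous_const (WithLp.prod_continuous_ofLp 2 ℝ H).fst) hz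

lemma add_smul_mem_eulerGraph {u : U} (hF : Continuous (F · u)) {z : WithLp 2 (ℝ × H)}
    (hz : z ∈ eulerGraph F x₀) {h : ℝ} (hh : 0 ≤ h) :
    z + h • WithLp.toLp 2 (1, F z.snd u) ∈ eulerGraph F x₀ := by
  have hcont : Continuous fun z : WithLp 2 (ℝ × H) => z + h • WithLp.toLp 2 (1, F z.snd u) := by
    have hsnd := (WithLp.prod_continuous_ofLp 2 ℝ H).snd
    exact continuous_id.add (((WithLp.prod_continuous_toLp 2 ℝ H).comp
      (continuous_const.prodMk (hF.comp hsnd))).const_smul h)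
  have hmaps : MapsTo (fun z : WithLp 2 (ℝ × H) => z + h • WithLp.toLp 2 (1, F z.snd u))
      {z | EulerReach F x₀ z.fst z.snd} {z | EulerReach F x₀ z.fst z.snd} := fun z hz => by
    simpa using EulerReach.step h u hz hh
  exact hmaps.closure hcont hz

lemma exists_isCompact_snd_mem_of_mem_eulerGraph [CompleteSpace H] [TopologicalSpace U]
    [CompactSpace U] [Nonempty U] {Λ : ℝ≥0} (hF : Continuous (Function.uncurry F))
    (hΛ : ∀ u, LipschitzWith Λ (F · u)) (x₀ : H) (T : ℝ) :
    ∃ K : Set H, IsCompact K ∧ ∀ z ∈ eulerGraph F x₀, z.fst ≤ T → z.snd ∈ K := by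
  refine ⟨closure {k | ∃ t ≤ T + 1, EulerReach F x₀ t k},
    (totallyBounded_eulerReach hF hΛ x₀ (T + 1)).closure.isCompact_of_isClosed isClosed_closure,
    fun z hz hzT => ?_⟩
  have hopen : IsOpen {z : WithLp 2 (ℝ × H) | z.fst < T + 1} :=
    isOpen_lt (WithLp.prod_continuous_ofLp 2 ℝ H).fst continuous_const
  refine map_mem_closure (WithLp.prod_continuous_ofLp 2 ℝ H).snd
    (hopen.inter_closure ⟨hzT.trans_lt (lt_add_one T), hz⟩) fun y hy => ?_
  exact ⟨y.fst, hy.1.le, hy.2⟩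

end InnerProductSpace

end Euler

section Comparison

open scoped NNReal

lemma exists_pos_forall_mem_thickening_lt {X : Type*} [PseudoEMetricSpace X] {K T : Set X}
    (hK : IsCompact K) (hT : IsClosed T) {Ψ : X → ℝ} (hΨ : UpperSemicontinuousOn Ψ T) {σ : ℝ}
    (hσ : ∀ z ∈ K ∩ T, Ψ z < σ) :
    ∃ r > 0, ∀ z ∈ T, z ∈ Metric.thickening r K → Ψ z < σ := by
  obtain ⟨V, hV, hTV⟩ := upperSemicontinuousOn_iff_preimage_Ici.1 hΨ σ
  have hKV : K ⊆ (T ∩ V)ᶜ := fun z hz hzV =>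
    (hσ z ⟨hz, hzV.1⟩).not_ge ((hTV.symm ▸ hzV : z ∈ T ∩ Ψ ⁻¹' Ici σ)).2
  obtain ⟨r, hr, hrV⟩ := hK.exists_thickening_subset_open (hT.inter hV).isOpen_compl hKV
  refine ⟨r, hr, fun z hz hzK => not_le.1 fun hle => hrV hzK ?_⟩
  rw [← hTV]
  exact ⟨hz, hle⟩

lemma exists_pos_forall_notMem_of_le_sub {X : Type*} [PseudoMetricSpace X] {K S B : Set X}
    (hK : IsCompact K) (hS : IsClosed S) (hB : IsClosed B) {φ₁ φ₂ : X → ℝ}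
    (hφ₁ : LowerSemicontinuousOn φ₁ S) (hφ₂ : UpperSemicontinuousOn φ₂ S)
    (hle : ∀ x ∈ S ∩ B, φ₂ x ≤ φ₁ x) {σ : ℝ} (hσ : 0 < σ) :
    ∃ r > 0, ∀ k ∈ K, ∀ x ∈ S, ∀ y ∈ S, dist x k < r → dist x y < r → σ ≤ φ₂ y - φ₁ x →
      x ∉ B ∧ y ∉ B := by
  let T : Set (X × X) := S ×ˢ S ∩ (Prod.fst ⁻¹' B ∪ Prod.snd ⁻¹' B)
  have hT : IsClosed T :=
    (hS.prod hS).inter ((hB.preimage continuous_fst).union (hB.preimage continuous_snd))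
  have hΨ : UpperSemicontinuousOn (fun z : X × X => φ₂ z.2 + -φ₁ z.1) T :=
    (hφ₂.comp continuousOn_snd fun z hz => hz.1.2).add
      (hφ₁.comp continuousOn_fst fun z hz => hz.1.1).neg
  have hdiag : ∀ z ∈ (fun k => (k, k)) '' K ∩ T, φ₂ z.2 + -φ₁ z.1 < σ := by
    rintro _ ⟨⟨k, -, rfl⟩, hkS, hkB⟩
    linarith [hle k ⟨hkS.1, hkB.elim id id⟩]
  obtain ⟨r, hr, hlt⟩ := exists_pos_forall_mem_thickening_lt
    (hK.image (f := fun k : X => (k, k)) (by fun_prop)) hT hΨ hdiag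
  refine ⟨r / 2, half_pos hr, fun k hk x hx y hy hxk hxy hσ_le => not_or.1 fun hxyB => ?_⟩
  have hnear : (x, y) ∈ Metric.thickening r ((fun k => (k, k)) '' K) := by
    refine Metric.mem_thickening_iff.2 ⟨(k, k), mem_image_of_mem _ hk, max_lt (by linarith) ?_⟩
    linarith [dist_triangle_left y k x]
  linarith [hlt (x, y) ⟨⟨hx, hy⟩, hxyB⟩ hnear]

variable {H U : Type*} [NormedAddCommGroup H]

/-- The argument of the logarithmic penalty `θ * (log (penalty η x y k) - log η)` which forces the
doubled variables `x`, `y` together and ties them to the reachable point `k`. -/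
def penalty (η : ℝ) (x y k : H) : ℝ :=
  η + (‖x - k‖ ^ 2 + ‖x - y‖ ^ 2)

lemma le_penalty (η : ℝ) (x y k : H) : η ≤ penalty η x y k :=
  le_add_of_nonneg_right (by positivity)

lemma penalty_pos {η : ℝ} (hη : 0 < η) (x y k : H) : 0 < penalty η x y k :=
  hη.trans_le (le_penalty η x y k)

lemma penalty_le_sq_of_log_le {η θ M r : ℝ} {x y k : H} (hη : η = r ^ 2 / Real.exp (M / θ))
    (hr : 0 < r) (hθ : 0 < θ) (hlog : θ * (Real.log (penalty η x y k) - Real.log η) ≤ M) :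
    penalty η x y k ≤ r ^ 2 := by
  have hη₀ : 0 < η := by rw [hη]; positivity
  have hle : Real.log (penalty η x y k) ≤ Real.log η + M / θ := by
    have := (le_div_iff₀' hθ).2 hlog
    linarith
  rwa [Real.log_le_iff_le_exp (penalty_pos hη₀ x y k), Real.exp_add, Real.exp_log hη₀, hη,
    div_mul_cancel₀ _ (Real.exp_pos _).ne', ← hη] at hle

lemma mul_log_penalty_sub_log_nonneg {η θ : ℝ} (hη : 0 < η) (hθ : 0 ≤ θ) (x y k : H) :
    0 ≤ θ * (Real.log (penalty η x y k) - Real.log η) :=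
  mul_nonneg hθ (sub_nonneg.2 (Real.log_le_log hη (le_penalty η x y k)))

lemma norm_sub_lt_of_penalty_le_sq {η r : ℝ} {x y k : H} (hη : 0 < η) (hr : 0 < r)
    (h : penalty η x y k ≤ r ^ 2) : ‖x - k‖ < r ∧ ‖x - y‖ < r := by
  unfold penalty at h
  constructor <;> refine lt_of_pow_lt_pow_left₀ 2 hr.le ?_
  · linarith [sq_nonneg ‖x - y‖]
  · linarith [sq_nonneg ‖x - k‖]

/-- The function maximized in the doubling of variables: `φ₂ y - φ₁ x`, with a penalty for the
distances of `x` to `y` and to the reachable point `k`, and a cost `δ` per unit of the time `t` at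
which `k` is reached, where `z = (t, k)`. -/
noncomputable def doubledDifference (φ₁ φ₂ : H → ℝ) (η θ δ : ℝ) (x y : H)
    (z : WithLp 2 (ℝ × H)) : ℝ :=
  φ₂ y - φ₁ x - (θ * (Real.log (penalty η x y z.snd) - Real.log η) + δ * z.fst)

lemma upperSemicontinuousOn_doubledDifference {S : Set H} {R : Set (WithLp 2 (ℝ × H))}
    {φ₁ φ₂ : H → ℝ} {η : ℝ} (θ δ : ℝ) (hφ₁ : LowerSemicontinuousOn φ₁ S)
    (hφ₂ : UpperSemicontinuousOn φ₂ S) (hη : 0 < η) :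
    UpperSemicontinuousOn (fun z : WithLp 2 (WithLp 2 (H × H) × WithLp 2 (ℝ × H)) =>
        doubledDifference φ₁ φ₂ η θ δ z.fst.fst z.fst.snd z.snd)
      (WithLp.ofLp ⁻¹' ((WithLp.ofLp ⁻¹' (S ×ˢ S)) ×ˢ R)) := by
  have hpen : Continuous fun z : WithLp 2 (WithLp 2 (H × H) × WithLp 2 (ℝ × H)) =>
      -(θ * (Real.log (penalty η z.fst.fst z.fst.snd z.snd.snd) - Real.log η) +
        δ * z.snd.fst) := by
    have hlog := Continuous.log (f := fun z : WithLp 2 (WithLp 2 (H × H) × WithLp 2 (ℝ × H)) =>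
      penalty η z.fst.fst z.fst.snd z.snd.snd) (by unfold penalty; fun_prop)
      fun z => (penalty_pos hη _ _ _).ne'
    fun_prop
  have h₂ := hφ₂.comp (g := fun z : WithLp 2 (WithLp 2 (H × H) × WithLp 2 (ℝ × H)) => z.fst.snd)
    (t := WithLp.ofLp ⁻¹' ((WithLp.ofLp ⁻¹' (S ×ˢ S)) ×ˢ R)) (by fun_prop) fun z hz => hz.1.2
  have h₁ := hφ₁.comp (g := fun z : WithLp 2 (WithLp 2 (H × H) × WithLp 2 (ℝ × H)) => z.fst.fst)
    (t := WithLp.ofLp ⁻¹' ((WithLp.ofLp ⁻¹' (S ×ˢ S)) ×ˢ R)) (by fun_prop) fun z hz => hz.1.1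
  have h := (h₂.add h₁.neg).add (hpen.upperSemicontinuous.upperSemicontinuousOn _)
  simpa only [doubledDifference, sub_eq_add_neg, Pi.neg_apply, Function.comp_apply] using h

lemma localization_of_doubledDifference_le {φ₁ φ₂ : H → ℝ} {M η θ δ r : ℝ} {x₀ x y : H}
    {z : WithLp 2 (ℝ × H)} (hη : η = r ^ 2 / Real.exp (M / θ))
    (hr : 0 < r) (hθ : 0 < θ) (hδ : 0 < δ) (hz : 0 ≤ z.fst) (hx₀ : 0 ≤ φ₂ x₀ - φ₁ x₀)
    (hM : φ₂ y - φ₁ x ≤ M)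
    (hle : doubledDifference φ₁ φ₂ η θ δ x₀ x₀ (WithLp.toLp 2 (0, x₀)) ≤
      doubledDifference φ₁ φ₂ η θ δ x y z) :
    φ₂ x₀ - φ₁ x₀ ≤ φ₂ y - φ₁ x ∧ z.fst ≤ M / δ ∧ ‖x - z.snd‖ < r ∧ ‖x - y‖ < r := by
  have hη₀ : 0 < η := by rw [hη]; positivity
  have hstart : doubledDifference φ₁ φ₂ η θ δ x₀ x₀ (WithLp.toLp 2 (0, x₀)) = φ₂ x₀ - φ₁ x₀ := by
    simp [doubledDifference, penalty]
  rw [hstart, doubledDifference] at hle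
  have hlog := mul_log_penalty_sub_log_nonneg hη₀ hθ.le x y z.snd
  have htime : 0 ≤ δ * z.fst := mul_nonneg hδ.le hz
  refine ⟨by linarith, (le_div_iff₀' hδ).2 (by linarith), ?_⟩
  exact norm_sub_lt_of_penalty_le_sq hη₀ hr
    (penalty_le_sq_of_log_le hη hr hθ (by linarith))

lemma exists_norm_le_of_norm_sub_le [TopologicalSpace U] [CompactSpace U] {F : H → U → H}
    {Λ : ℝ≥0} (hF : Continuous (Function.uncurry F)) (hΛ : ∀ u, LipschitzWith Λ (F · u))
    {K : Set H} (hK : IsCompact K) (ρ : ℝ) :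
    ∃ b ≥ 0, ∀ k ∈ K, ∀ x u, ‖x - k‖ ≤ ρ → ‖F x u‖ ≤ b := by
  obtain ⟨c, hc⟩ := ((hK.prod isCompact_univ).image hF).isBounded.exists_norm_le
  refine ⟨max 0 (c + Λ * ρ), le_max_left _ _, fun k hk x u hx => le_max_of_le_right ?_⟩
  have hk : ‖F k u‖ ≤ c := hc _ ⟨(k, u), ⟨hk, mem_univ u⟩, rfl⟩
  have hxk : ‖F x u - F k u‖ ≤ Λ * ρ := ((hΛ u).norm_sub_le x k).trans (by gcongr)
  linarith [norm_le_insert' (F x u) (F k u)]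

variable [InnerProductSpace ℝ H]

/-- The weight `θ / penalty` is the slope of the logarithm: it makes the Lipschitz error of order
`θ`, whatever the size of the penalty. -/
lemma div_penalty_mul_inner_le {G : H → H} {Λ : ℝ≥0} (hG : LipschitzWith Λ G) {η θ : ℝ}
    (hη : 0 < η) (hθ : 0 ≤ θ) (x y k : H) :
    θ / penalty η x y k * (2 * (inner ℝ (y - x) (G y - G x) + inner ℝ (k - x) (G k - G x))) ≤
      2 * Λ * θ := by
  have hpair (y : H) : inner ℝ (y - x) (G y - G x) ≤ Λ * ‖x - y‖ ^ 2 :=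
    calc inner ℝ (y - x) (G y - G x) ≤ ‖y - x‖ * ‖G y - G x‖ := real_inner_le_norm _ _
      _ ≤ ‖y - x‖ * (Λ * ‖y - x‖) := by gcongr; exact hG.norm_sub_le y x
      _ = Λ * ‖x - y‖ ^ 2 := by rw [norm_sub_rev]; ring
  have hpos := penalty_pos hη x y k
  calc _ ≤ θ / penalty η x y k * (2 * (Λ * penalty η x y k)) := by
        gcongr
        unfold penalty
        linarith [hpair y, hpair k, mul_nonneg Λ.coe_nonneg hη.le]
    _ = 2 * Λ * θ := by field_simp

section Slopes

variable {S : Set H} {R : Set (WithLp 2 (ℝ × H))}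

lemma mem_proximalSuperdifferential_congr {φ ψ : H → ℝ} {x p : H}
    (h : ∀ y, φ y - φ x = ψ y - ψ x) :
    p ∈ proximalSuperdifferential φ S x ↔ p ∈ proximalSuperdifferential ψ S x := by
  refine exists_congr fun C => forall₂_congr fun y _ => ?_
  constructor <;> intro hC <;> linarith [h y]

lemma smul_mem_proximalSuperdifferential_penalty_fst (η : ℝ) (x y k : H) :
    (2 : ℝ) • (x - k + (x - y)) ∈ proximalSuperdifferential (penalty η · y k) S x := by
  rw [smul_add, mem_proximalSuperdifferential_congr
    (ψ := fun x => ‖x - k‖ ^ 2 + ‖x - y‖ ^ 2) fun x' => by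
      simp only [penalty, add_sub_add_left_eq_sub]]
  exact add_mem_proximalSuperdifferential
    (smul_sub_mem_proximalSuperdifferential_norm_sq S x k)
    (smul_sub_mem_proximalSuperdifferential_norm_sq S x y)

lemma smul_mem_proximalSuperdifferential_penalty_snd (η : ℝ) (x y k : H) :
    (2 : ℝ) • (y - x) ∈ proximalSuperdifferential (penalty η x · k) S y := by
  rw [mem_proximalSuperdifferential_congr (ψ := fun y => ‖y - x‖ ^ 2) fun y' => by
    simp only [penalty, norm_sub_rev x, add_sub_add_left_eq_sub]]
  exact smul_sub_mem_proximalSuperdifferential_norm_sq S y x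

lemma toLp_mem_proximalSuperdifferential_penalty_snd (η : ℝ) (x y : H)
    (z : WithLp 2 (ℝ × H)) :
    WithLp.toLp 2 (0, (2 : ℝ) • (z.snd - x)) ∈
      proximalSuperdifferential (fun z => penalty η x y z.snd) R z := by
  refine ⟨1, fun z' _ => ?_⟩
  have hexpand := norm_sub_sq_eq_add_inner_add z.snd z'.snd x
  have hsnd : ‖z'.snd - z.snd‖ ^ 2 ≤ ‖z' - z‖ ^ 2 := by
    gcongr
    exact WithLp.norm_snd_le (x := z' - z)
  have hinner : inner ℝ (WithLp.toLp 2 ((0 : ℝ), (2 : ℝ) • (z.snd - x))) (z' - z) =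
      inner ℝ ((2 : ℝ) • (z.snd - x)) (z'.snd - z.snd) := by
    simp [WithLp.prod_inner_apply]
  rw [hinner]
  simp only [penalty, norm_sub_rev x]
  linarith

lemma toLp_mem_proximalSuperdifferential_mul_fst (δ : ℝ) (z : WithLp 2 (ℝ × H)) :
    WithLp.toLp 2 (δ, (0 : H)) ∈ proximalSuperdifferential (fun z => δ * z.fst) R z :=
  ⟨0, fun z' _ => by
    have hinner : inner ℝ (WithLp.toLp 2 (δ, (0 : H))) (z' - z) = δ * (z'.fst - z.fst) := by
      simp [WithLp.prod_inner_apply, mul_comm]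
    rw [hinner]
    linarith⟩

end Slopes

section Touching

variable {S : Set H} {R : Set (WithLp 2 (ℝ × H))} {φ₁ φ₂ : H → ℝ} {M η θ δ μ : ℝ} {x₀ : H}

variable {z P : WithLp 2 (WithLp 2 (H × H) × WithLp 2 (ℝ × H))}

lemma smul_neg_mem_proximalSubdifferential_of_doubledDifference (hη : 0 < η) (hθ : 0 ≤ θ)
    (hP : P ∈ proximalSuperdifferential (fun z => doubledDifference φ₁ φ₂ η θ δ
      z.fst.fst z.fst.snd z.snd) (WithLp.ofLp ⁻¹' ((WithLp.ofLp ⁻¹' (S ×ˢ S)) ×ˢ R)) z)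
    (hz : z ∈ WithLp.ofLp ⁻¹' ((WithLp.ofLp ⁻¹' (S ×ˢ S)) ×ˢ R)) :
    -(P.fst.fst + (θ / penalty η z.fst.fst z.fst.snd z.snd.snd) •
      (2 : ℝ) • (z.fst.fst - z.snd.snd + (z.fst.fst - z.fst.snd))) ∈
      proximalSubdifferential φ₁ S z.fst.fst := by
  have h : _ ∈ proximalSuperdifferential
      (doubledDifference φ₁ φ₂ η θ δ · z.fst.snd z.snd) S z.fst.fst :=
    fst_mem_proximalSuperdifferential (fst_mem_proximalSuperdifferential hP hz.2) hz.1.2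
  have hlog := smul_mem_proximalSuperdifferential_log (S := S)
    (smul_mem_proximalSuperdifferential_penalty_fst η z.fst.fst z.fst.snd z.snd.snd)
    (fun _ _ => penalty_pos hη _ _ _) (penalty_pos hη _ _ _) hθ
  have hsum := add_mem_proximalSuperdifferential h hlog
  rw [mem_proximalSuperdifferential_congr (ψ := fun x => -φ₁ x) fun x => by
    simp only [doubledDifference]; ring] at hsum
  simpa only [neg_neg] using neg_mem_proximalSubdifferential_neg.2 hsum

lemma add_smul_mem_proximalSuperdifferential_of_doubledDifference (hη : 0 < η) (hθ : 0 ≤ θ)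
    (hP : P ∈ proximalSuperdifferential (fun z => doubledDifference φ₁ φ₂ η θ δ
      z.fst.fst z.fst.snd z.snd) (WithLp.ofLp ⁻¹' ((WithLp.ofLp ⁻¹' (S ×ˢ S)) ×ˢ R)) z)
    (hz : z ∈ WithLp.ofLp ⁻¹' ((WithLp.ofLp ⁻¹' (S ×ˢ S)) ×ˢ R)) :
    P.fst.snd + (θ / penalty η z.fst.fst z.fst.snd z.snd.snd) •
      (2 : ℝ) • (z.fst.snd - z.fst.fst) ∈ proximalSuperdifferential φ₂ S z.fst.snd := by
  have h : _ ∈ proximalSuperdifferential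
      (doubledDifference φ₁ φ₂ η θ δ z.fst.fst · z.snd) S z.fst.snd :=
    snd_mem_proximalSuperdifferential (fst_mem_proximalSuperdifferential hP hz.2) hz.1.1
  have hlog := smul_mem_proximalSuperdifferential_log (S := S)
    (smul_mem_proximalSuperdifferential_penalty_snd η z.fst.fst z.fst.snd z.snd.snd)
    (fun _ _ => penalty_pos hη _ _ _) (penalty_pos hη _ _ _) hθ
  have hsum := add_mem_proximalSuperdifferential h hlog
  rwa [mem_proximalSuperdifferential_congr (ψ := φ₂) fun x => by
    simp only [doubledDifference]; ring] at hsum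

lemma add_toLp_mem_proximalSuperdifferential_of_doubledDifference (hη : 0 < η) (hθ : 0 ≤ θ)
    (hP : P ∈ proximalSuperdifferential (fun z => doubledDifference φ₁ φ₂ η θ δ
      z.fst.fst z.fst.snd z.snd) (WithLp.ofLp ⁻¹' ((WithLp.ofLp ⁻¹' (S ×ˢ S)) ×ˢ R)) z)
    (hz : z ∈ WithLp.ofLp ⁻¹' ((WithLp.ofLp ⁻¹' (S ×ˢ S)) ×ˢ R)) :
    P.snd + WithLp.toLp 2 (δ, (θ / penalty η z.fst.fst z.fst.snd z.snd.snd) •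
      (2 : ℝ) • (z.snd.snd - z.fst.fst)) ∈ proximalSuperdifferential (fun _ => 0) R z.snd := by
  have h : _ ∈ proximalSuperdifferential
      (doubledDifference φ₁ φ₂ η θ δ z.fst.fst z.fst.snd) R z.snd :=
    snd_mem_proximalSuperdifferential hP hz.1
  have hlog := smul_mem_proximalSuperdifferential_log (S := R)
    (toLp_mem_proximalSuperdifferential_penalty_snd η z.fst.fst z.fst.snd z.snd)
    (fun _ _ => penalty_pos hη _ _ _) (penalty_pos hη _ _ _) hθ
  have hsum := add_mem_proximalSuperdifferential h (add_mem_proximalSuperdifferential hlog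
    (toLp_mem_proximalSuperdifferential_mul_fst δ z.snd))
  rw [mem_proximalSuperdifferential_congr (ψ := fun _ => 0) fun x => by
    simp only [doubledDifference]; ring] at hsum
  simpa only [← WithLp.toLp_smul, ← WithLp.toLp_add, Prod.smul_mk, Prod.mk_add_mk, smul_zero,
    zero_add, add_zero] using hsum

lemma exists_almost_max_doubledDifference [CompleteSpace H] (hS : IsClosed S) (hR : IsClosed R)
    (hφ₁ : LowerSemicontinuousOn φ₁ S) (hφ₂ : UpperSemicontinuousOn φ₂ S)
    (hM : ∀ x ∈ S, ∀ y ∈ S, φ₂ y - φ₁ x ≤ M) (hRt : ∀ z ∈ R, 0 ≤ z.fst) (hη : 0 < η)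
    (hθ : 0 ≤ θ) (hδ : 0 ≤ δ) (hμ : 0 < μ) (hx₀ : x₀ ∈ S) {z₀ : WithLp 2 (ℝ × H)}
    (hz₀ : z₀ ∈ R) :
    ∃ x ∈ S, ∃ y ∈ S, ∃ z ∈ R,
      doubledDifference φ₁ φ₂ η θ δ x₀ x₀ z₀ ≤ doubledDifference φ₁ φ₂ η θ δ x y z ∧
      ∃ p ∈ proximalSubdifferential φ₁ S x, ∃ q ∈ proximalSuperdifferential φ₂ S y,
      ∃ P ∈ proximalSuperdifferential (fun _ => 0) R z,
        ‖-p - (θ / penalty η x y z.snd) • (2 : ℝ) • (x - z.snd + (x - y))‖ ≤ μ ∧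
        ‖q - (θ / penalty η x y z.snd) • (2 : ℝ) • (y - x)‖ ≤ μ ∧
        ‖P - WithLp.toLp 2 (δ, (θ / penalty η x y z.snd) • (2 : ℝ) • (z.snd - x))‖ ≤ μ := by
  have hclosed : IsClosed (WithLp.ofLp ⁻¹' ((WithLp.ofLp ⁻¹' (S ×ˢ S)) ×ˢ R) :
      Set (WithLp 2 (WithLp 2 (H × H) × WithLp 2 (ℝ × H)))) :=
    (((hS.prod hS).preimage (WithLp.prod_continuous_ofLp 2 H H)).prod hR).preimage
      (WithLp.prod_continuous_ofLp 2 _ _)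
  have hbdd : BddAbove ((fun z : WithLp 2 (WithLp 2 (H × H) × WithLp 2 (ℝ × H)) =>
      doubledDifference φ₁ φ₂ η θ δ z.fst.fst z.fst.snd z.snd) ''
      (WithLp.ofLp ⁻¹' ((WithLp.ofLp ⁻¹' (S ×ˢ S)) ×ˢ R))) := by
    refine ⟨M, forall_mem_image.2 fun z hz => (sub_le_self _ ?_).trans (hM _ hz.1.1 _ hz.1.2)⟩
    exact add_nonneg (mul_log_penalty_sub_log_nonneg hη hθ _ _ _) (mul_nonneg hδ (hRt _ hz.2))
  obtain ⟨z, hz, hle, P, hP, hPμ⟩ := exists_mem_proximalSuperdifferential hclosed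
    (upperSemicontinuousOn_doubledDifference θ δ hφ₁ hφ₂ hη) hbdd
    (x₀ := WithLp.toLp 2 (WithLp.toLp 2 (x₀, x₀), z₀)) ⟨⟨hx₀, hx₀⟩, hz₀⟩ hμ
  refine ⟨z.fst.fst, hz.1.1, z.fst.snd, hz.1.2, z.snd, hz.2, hle,
    _, smul_neg_mem_proximalSubdifferential_of_doubledDifference hη hθ hP hz,
    _, add_smul_mem_proximalSuperdifferential_of_doubledDifference hη hθ hP hz,
    _, add_toLp_mem_proximalSuperdifferential_of_doubledDifference hη hθ hP hz, ?_⟩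
  rw [neg_neg, add_sub_cancel_right, add_sub_cancel_right, add_sub_cancel_right]
  have hfst := WithLp.norm_fst_le (x := P)
  exact ⟨(WithLp.norm_fst_le (x := P.fst)).trans (hfst.trans hPμ),
    (WithLp.norm_snd_le (x := P.fst)).trans (hfst.trans hPμ),
    (WithLp.norm_snd_le (x := P)).trans hPμ⟩

lemma inner_le_inner_add_of_norm_sub_le {p q v : H} {b : ℝ} (hpq : ‖p - q‖ ≤ μ)
    (hv : ‖v‖ ≤ b) : inner ℝ p v ≤ inner ℝ q v + μ * b := by
  have h := real_inner_le_norm (p - q) v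
  rw [inner_sub_left] at h
  have := mul_le_mul hpq hv (norm_nonneg v) ((norm_nonneg _).trans hpq)
  linarith

lemma inner_toLp_toLp_one (c : ℝ) (v w : H) :
    inner ℝ (WithLp.toLp 2 (c, v)) (WithLp.toLp 2 ((1 : ℝ), w)) = c + inner ℝ v w := by
  simp [WithLp.prod_inner_apply]

/-- The three slopes of the penalty add up to zero, so that only the variation of `G` remains. -/
lemma inner_add_inner_add_inner_le {G : H → H} {Λ : ℝ≥0} (hG : LipschitzWith Λ G) {b : ℝ}
    {x y k p q : H} {P : WithLp 2 (ℝ × H)} (hη : 0 < η) (hθ : 0 ≤ θ)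
    (hp : ‖-p - (θ / penalty η x y k) • (2 : ℝ) • (x - k + (x - y))‖ ≤ μ)
    (hq : ‖q - (θ / penalty η x y k) • (2 : ℝ) • (y - x)‖ ≤ μ)
    (hP : ‖P - WithLp.toLp 2 (δ, (θ / penalty η x y k) • (2 : ℝ) • (k - x))‖ ≤ μ)
    (hx : ‖G x‖ ≤ b) (hy : ‖G y‖ ≤ b) (hk : ‖G k‖ ≤ b) :
    inner ℝ q (G y) - inner ℝ p (G x) + inner ℝ P (WithLp.toLp 2 (1, G k)) ≤
      2 * Λ * θ + δ + μ * (3 * b + 1) := by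
  have hPk : ‖WithLp.toLp 2 ((1 : ℝ), G k)‖ ≤ 1 + b := by
    have hsplit : WithLp.toLp 2 ((1 : ℝ), G k) =
        WithLp.toLp 2 ((1 : ℝ), (0 : H)) + WithLp.toLp 2 ((0 : ℝ), G k) := by
      rw [← WithLp.toLp_add, Prod.mk_add_mk, add_zero, zero_add]
    rw [hsplit]
    refine (norm_add_le _ _).trans ?_
    rw [WithLp.norm_toLp_fst, WithLp.norm_toLp_snd, norm_one]
    gcongr
  have hpx := inner_le_inner_add_of_norm_sub_le hp hx
  have hqy := inner_le_inner_add_of_norm_sub_le hq hy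
  have hPk := inner_le_inner_add_of_norm_sub_le hP hPk
  have hdrift := div_penalty_mul_inner_le hG hη hθ x y k
  rw [inner_toLp_toLp_one δ ((θ / penalty η x y k) • (2 : ℝ) • (k - x))] at hPk
  simp only [inner_sub_left, inner_sub_right, inner_add_left, inner_neg_left,
    real_inner_smul_left] at hpx hqy hPk hdrift
  linarith

end Touching

variable {S : Set H} {φ₁ φ₂ : H → ℝ} {M η θ δ μ : ℝ} {x₀ x y : H} {z : WithLp 2 (ℝ × H)}
variable [TopologicalSpace U] [CompactSpace U] [Nonempty U] {F : H → U → H} {Λ : ℝ≥0}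

lemma sub_le_of_proximal_inequalities
    (hF : Continuous (Function.uncurry F)) (hΛ : ∀ u, LipschitzWith Λ (F · u))
    (hη : 0 < η) (hθ : 0 ≤ θ) (hz : z ∈ eulerGraph F x₀) {b : ℝ} (hx : ∀ u, ‖F x u‖ ≤ b)
    (hy : ∀ u, ‖F y u‖ ≤ b) (hk : ∀ u, ‖F z.snd u‖ ≤ b) {p q : H}
    {P : WithLp 2 (ℝ × H)} (hPz : P ∈ proximalSuperdifferential (fun _ => 0) (eulerGraph F x₀) z)
    (hp : ‖-p - (θ / penalty η x y z.snd) • (2 : ℝ) • (x - z.snd + (x - y))‖ ≤ μ)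
    (hq : ‖q - (θ / penalty η x y z.snd) • (2 : ℝ) • (y - x)‖ ≤ μ)
    (hP : ‖P - WithLp.toLp 2 (δ, (θ / penalty η x y z.snd) • (2 : ℝ) • (z.snd - x))‖ ≤ μ)
    (hsuper : (⨅ u, inner ℝ p (F x u)) + 1 - φ₁ x ≤ 0)
    (hsub : 0 ≤ (⨅ u, inner ℝ q (F y u)) + 1 - φ₂ y) :
    φ₂ y - φ₁ x ≤ 2 * Λ * θ + δ + μ * (3 * b + 1) := by
  refine le_of_forall_pos_le_add fun ε hε => ?_
  have hF' (x : H) : Continuous (F x) := hF.comp (.prodMk_right x)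
  obtain ⟨u, hu⟩ := exists_lt_of_ciInf_lt (lt_add_of_pos_right (⨅ u, inner ℝ p (F x u)) hε)
  have hyu : ⨅ u, inner ℝ q (F y u) ≤ inner ℝ q (F y u) :=
    ciInf_le (isCompact_range (continuous_const.inner (hF' y))).bddBelow u
  have hzu : 0 ≤ inner ℝ P (WithLp.toLp 2 (1, F z.snd u)) := by
    refine inner_nonneg_of_mem_proximalSuperdifferential hPz (Eventually.frequently ?_)
    filter_upwards [self_mem_nhdsWithin] with h hh
    exact ⟨add_smul_mem_eulerGraph (hΛ u).continuous hz (le_of_lt hh), le_rfl⟩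
  have := inner_add_inner_add_inner_le (hΛ u) hη hθ hp hq hP (hx u) (hy u) (hk u)
  linarith

theorem le_of_proximal_inequalities [CompleteSpace H] (hF : Continuous (Function.uncurry F))
    (hΛ : ∀ u, LipschitzWith Λ (F · u)) {B : Set H} (hS : IsClosed S) (hB : IsClosed B)
    (hφ₁ : LowerSemicontinuousOn φ₁ S) (hφ₂ : UpperSemicontinuousOn φ₂ S)
    (hM : ∀ x ∈ S, ∀ y ∈ S, φ₂ y - φ₁ x ≤ M) (hle : ∀ x ∈ S ∩ B, φ₂ x ≤ φ₁ x)
    (hsuper : ∀ x ∈ S \ B, ∀ p ∈ proximalSubdifferential φ₁ S x,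
      (⨅ u, inner ℝ p (F x u)) + 1 - φ₁ x ≤ 0)
    (hsub : ∀ x ∈ S \ B, ∀ p ∈ proximalSuperdifferential φ₂ S x,
      0 ≤ (⨅ u, inner ℝ p (F x u)) + 1 - φ₂ x) :
    ∀ x ∈ S, φ₂ x ≤ φ₁ x := by
  intro x₀ hx₀
  by_contra! hlt
  obtain ⟨σ, hσ, hσ_eq⟩ : ∃ σ > 0, σ = φ₂ x₀ - φ₁ x₀ := ⟨_, sub_pos.2 hlt, rfl⟩
  obtain ⟨K, hK, hKmem⟩ := exists_isCompact_snd_mem_of_mem_eulerGraph hF hΛ x₀ (M / (σ / 4))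
  obtain ⟨r, hr, hsep⟩ := exists_pos_forall_notMem_of_le_sub hK hS hB hφ₁ hφ₂ hle hσ
  obtain ⟨b, hb, hFb⟩ := exists_norm_le_of_norm_sub_le hF hΛ hK (2 * r)
  obtain ⟨θ, hθ, hθΛ⟩ : ∃ θ > 0, 2 * Λ * θ ≤ σ / 4 := by
    refine ⟨σ / (8 * (Λ + 1)), by positivity, ?_⟩
    rw [← mul_div_assoc, div_le_div_iff₀ (by positivity) (by norm_num)]
    nlinarith
  obtain ⟨μ, hμ, hμb⟩ : ∃ μ > 0, μ * (3 * b + 1) = σ / 4 :=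
    ⟨σ / 4 / (3 * b + 1), by positivity, div_mul_cancel₀ _ (by positivity)⟩
  have hη : 0 < r ^ 2 / Real.exp (M / θ) := by positivity
  obtain ⟨x, hx, y, hy, z, hz, hmax, p, hpx, q, hqy, P, hPz, hp, hq, hP⟩ :=
    exists_almost_max_doubledDifference hS isClosed_closure hφ₁ hφ₂ hM
      (fun z => fst_nonneg_of_mem_eulerGraph) hη hθ.le (by positivity : 0 ≤ σ / 4) hμ hx₀
      (start_mem_eulerGraph (F := F))
  obtain ⟨hgap, htime, hxk, hxy⟩ := localization_of_doubledDifference_le rfl hr hθ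
    (by positivity) (fst_nonneg_of_mem_eulerGraph hz) (by linarith) (hM x hx y hy) hmax
  have hk := hKmem z hz htime
  obtain ⟨hxB, hyB⟩ := hsep z.snd hk x hx y hy (by rwa [dist_eq_norm]) (by rwa [dist_eq_norm])
    (hσ_eq ▸ hgap)
  have hyk : ‖y - z.snd‖ ≤ 2 * r := by
    linarith [norm_sub_le_norm_sub_add_norm_sub y x z.snd, norm_sub_rev x y]
  have := sub_le_of_proximal_inequalities hF hΛ hη hθ.le hz
    (fun u => hFb _ hk x u (by linarith)) (fun u => hFb _ hk y u hyk)
    (fun u => hFb _ hk _ u (by rw [sub_self, norm_zero]; positivity)) hPz hp hq hP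
    (hsuper x ⟨hx, hxB⟩ p hpx) (hsub y ⟨hy, hyB⟩ q hqy)
  linarith

end Comparison

section Law

variable {d : ℕ} {Ω : Type*} [MeasurableSpace Ω] {μ : Measure Ω}

lemma lintegral_edist_sq_eq (X Y : Lp (E d) 2 μ) :
    ∫⁻ ω, edist (X ω) (Y ω) ^ 2 ∂μ = ENNReal.ofReal (‖X - Y‖ ^ 2) := by
  have hpow := eLpNorm_nnreal_pow_eq_lintegral (f := ⇑(X - Y)) (μ := μ) (p := 2) two_ne_zero
  simp only [NNReal.coe_ofNat, ENNReal.rpow_ofNat, ENNReal.coe_ofNat] at hpow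
  rw [ENNReal.ofReal_pow (norm_nonneg _), Lp.norm_def, ENNReal.ofReal_toReal (Lp.eLpNorm_ne_top _),
    hpow]
  refine lintegral_congr_ae ?_
  filter_upwards [Lp.coeFn_sub X Y] with ω hω
  rw [hω, Pi.sub_apply, edist_eq_enorm_sub]

variable [IsProbabilityMeasure μ]

lemma Lp_norm_le_of_ae_norm_le {V : Type*} [NormedAddCommGroup V] {X : Lp V 2 μ} {C : ℝ}
    (hC : 0 ≤ C) (h : ∀ᵐ ω ∂μ, ‖X ω‖ ≤ C) : ‖X‖ ≤ C := by
  simpa [measureUnivNNReal] using Lp.norm_le_of_ae_bound hC h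

/-- The law of a square integrable random variable. -/
noncomputable def law (X : Lp (E d) 2 μ) : P2 d where
  toMeasure := μ.map X
  isProb := Measure.isProbabilityMeasure_map (Lp.aestronglyMeasurable X).aemeasurable
  memLp_id := (memLp_map_measure_iff aestronglyMeasurable_id
    (Lp.aestronglyMeasurable X).aemeasurable).2 (Lp.memLp X)

lemma measurePreserving_law (X : Lp (E d) 2 μ) : MeasurePreserving X μ (law X).toMeasure :=
  ⟨(Lp.stronglyMeasurable X).measurable, rfl⟩

lemma W2_law_le (X Y : Lp (E d) 2 μ) : W2 (law X) (law Y) ≤ ‖X - Y‖ := by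
  have hXY : Measurable fun ω => (X ω, Y ω) :=
    (Lp.stronglyMeasurable X).measurable.prodMk (Lp.stronglyMeasurable Y).measurable
  have hplan : IsPlan (law X) (law Y) (μ.map fun ω => (X ω, Y ω)) :=
    ⟨Measure.map_map measurable_fst hXY, Measure.map_map measurable_snd hXY⟩
  refine Real.sqrt_le_iff.2 ⟨norm_nonneg _, ENNReal.toReal_le_of_le_ofReal (sq_nonneg _) ?_⟩
  refine (iInf₂_le _ hplan).trans_eq ?_
  rw [lintegral_map (by fun_prop) hXY, lintegral_edist_sq_eq]

lemma continuous_law : Continuous (law : Lp (E d) 2 μ → P2 d) := by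
  refine continuous_def.2 fun s hs => Metric.isOpen_iff.2 fun X hX => ?_
  obtain ⟨r, hr, hrs⟩ := hs (law X) hX
  refine ⟨r, hr, fun Y hY => hrs (law Y) ((W2_law_le X Y).trans_lt ?_)⟩
  rwa [← dist_eq_norm, dist_comm]

/-- The identity of `ℝ^d` as a random variable on the probability space `(ℝ^d, m)`; its law
is `m`. -/
noncomputable def P2.idLp (m : P2 d) : Lp (E d) 2 m.toMeasure := m.memLp_id.toLp _

lemma law_idLp (m : P2 d) : law m.idLp = m := by
  ext1
  change m.toMeasure.map m.idLp = m.toMeasure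
  rw [P2.idLp, Measure.map_congr m.memLp_id.coeFn_toLp]
  exact Measure.map_id

lemma W2_self (m : P2 d) : W2 m m = 0 := by
  have h := W2_law_le m.idLp m.idLp
  rw [law_idLp, sub_self, norm_zero] at h
  exact le_antisymm h (Real.sqrt_nonneg _)

/-- The isometric embedding `F ↦ F(X)` of the vector fields in `L²(law X)` into the random
variables. -/
noncomputable def compLaw (X : Lp (E d) 2 μ) :
    Lp (E d) 2 (law X).toMeasure →ₗᵢ[ℝ] Lp (E d) 2 μ :=
  Lp.compMeasurePreservingₗᵢ ℝ X (measurePreserving_law X)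

variable {X p : Lp (E d) 2 μ} {F s : E d → E d}

lemma coeFn_compLaw_toLp (hF : MemLp F 2 (law X).toMeasure) :
    compLaw X (hF.toLp F) =ᵐ[μ] fun ω => F (X ω) :=
  (hF.comp_measurePreserving (measurePreserving_law X)).coeFn_toLp

lemma law_add_smul_compLaw (hF : MemLp F 2 (law X).toMeasure) (h : ℝ) :
    law (X + h • compLaw X (hF.toLp F)) = (law X).displace F hF h := by
  ext1
  change μ.map (X + h • compLaw X (hF.toLp F) : Lp (E d) 2 μ) =
    (μ.map X).map (fun x => x + h • F x)
  have hmeas : AEMeasurable (fun x => x + h • F x) (μ.map X) :=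
    ((law X).memLp_id.add (hF.const_smul h)).aestronglyMeasurable.aemeasurable
  rw [AEMeasurable.map_map_of_aemeasurable hmeas (Lp.aestronglyMeasurable X).aemeasurable]
  refine Measure.map_congr ?_
  filter_upwards [Lp.coeFn_add X (h • compLaw X (hF.toLp F)),
    Lp.coeFn_smul h (compLaw X (hF.toLp F)), coeFn_compLaw_toLp hF] with ω hadd hsmul hcomp
  rw [hadd, Pi.add_apply, hsmul, Pi.smul_apply, hcomp, Function.comp_apply]

lemma pairing_neg (m : P2 d) (s F : E d → E d) : pairing m (-s) F = -pairing m s F := by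
  simp only [pairing, Pi.neg_apply, inner_neg_left, integral_neg]

lemma subdifferential_hadamard_subset (κ : DiffKind) (ψ : P2 d → ℝ) (m : P2 d) :
    subdifferential .hadamard ψ m ⊆ subdifferential κ ψ m := by
  cases κ with
  | hadamard => exact subset_rfl
  | radial =>
    rintro s ⟨hs, hle⟩
    refine ⟨hs, fun F hF ε hε => ?_⟩
    filter_upwards [hle F hF 0 ε hε] with h hh
    exact hh F hF (by simp)

lemma mem_superdifferential_of_neg {κ : DiffKind} {ψ : P2 d → ℝ} {m : P2 d}
    (hs : -s ∈ subdifferential κ (fun m => -ψ m) m) : s ∈ superdifferential κ ψ m := by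
  cases κ with
  | radial =>
    refine ⟨by simpa using hs.1.neg, fun F hF ε hε => ?_⟩
    filter_upwards [hs.2 F hF ε hε] with h hh
    rw [pairing_neg] at hh
    linarith
  | hadamard =>
    refine ⟨by simpa using hs.1.neg, fun F hF C ε hε => ?_⟩
    filter_upwards [hs.2 F hF C ε hε] with h hh F' hF' hle
    have := hh F' hF' hle
    rw [pairing_neg] at this
    linarith

/-- The vector field `s` represents the conditional expectation of `p` given `X`, that is
`s(X) = 𝔼[p | X]`; this is expressed by duality with the fields in `L²(law X)`. -/
def IsConditionalField (X p : Lp (E d) 2 μ) (s : E d → E d) : Prop :=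
  MemLp s 2 (law X).toMeasure ∧ ∀ (F : E d → E d) (hF : MemLp F 2 (law X).toMeasure),
    pairing (law X) s F = inner ℝ p (compLaw X (hF.toLp F))

lemma exists_isConditionalField (X p : Lp (E d) 2 μ) :
    ∃ s : E d → E d, IsConditionalField X p s := by
  refine ⟨(compLaw X).toContinuousLinearMap.adjoint p, Lp.memLp _, fun F hF => ?_⟩
  refine Eq.trans ?_ ((compLaw X).toContinuousLinearMap.adjoint_inner_left (hF.toLp F) p)
  rw [L2.inner_def]
  refine integral_congr_ae ?_
  filter_upwards [hF.coeFn_toLp] with x hx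
  rw [hx]

namespace IsConditionalField

lemma neg (hs : IsConditionalField X p s) : IsConditionalField X (-p) (-s) :=
  ⟨hs.1.neg, fun F hF => by rw [pairing_neg, hs.2 F hF, inner_neg_left]⟩

lemma mem_subdifferential (hs : IsConditionalField X p s) {ψ : P2 d → ℝ} {S : Set (Lp (E d) 2 μ)}
    (hS : S ∈ 𝓝 X) (hp : p ∈ proximalSubdifferential (fun Y => ψ (law Y)) S X) (κ : DiffKind) :
    s ∈ subdifferential κ ψ (law X) := by
  refine subdifferential_hadamard_subset κ ψ (law X) ⟨hs.1, fun F hF C ε hε => ?_⟩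
  filter_upwards [eventually_le_sub_of_mem_proximalSubdifferential hp hS
    (compLaw X (hF.toLp F)) |C| hε, self_mem_nhdsWithin] with h hle (hpos : 0 < h) F' hF' hFF'
  rw [hs.2 F hF, ← law_add_smul_compLaw hF' h]
  refine hle _ ?_
  rw [← map_sub, LinearIsometry.norm_map, ← MemLp.toLp_sub, Lp.norm_toLp]
  refine ENNReal.toReal_le_of_le_ofReal (by positivity) (hFF'.trans ?_)
  gcongr
  exact le_abs_self C

lemma mem_superdifferential (hs : IsConditionalField X p s) {ψ : P2 d → ℝ}
    {S : Set (Lp (E d) 2 μ)} (hS : S ∈ 𝓝 X)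
    (hp : p ∈ proximalSuperdifferential (fun Y => ψ (law Y)) S X) (κ : DiffKind) :
    s ∈ superdifferential κ ψ (law X) :=
  mem_superdifferential_of_neg <| hs.neg.mem_subdifferential (ψ := fun m => -ψ m) hS
    (neg_mem_proximalSubdifferential_neg.2 hp) κ

end IsConditionalField

end Law

section LiftField

open scoped NNReal

variable {d : ℕ} {U Ω : Type*} [MeasurableSpace Ω] {μ : Measure Ω} [IsProbabilityMeasure μ]
  {f : E d → P2 d → U → E d} {L : ℝ≥0}

/-- Lipschitz continuity of a velocity field in the position and the measure, the latter with
respect to the Wasserstein distance, uniformly in the control. -/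
def IsLipschitzField (L : ℝ≥0) (f : E d → P2 d → U → E d) : Prop :=
  ∀ (x₁ x₂ : E d) (m₁ m₂ : P2 d) (u : U),
    ‖f x₁ m₁ u - f x₂ m₂ u‖ ≤ L * (‖x₁ - x₂‖ + W2 m₁ m₂)

namespace IsLipschitzField

lemma lipschitzWith (hf : IsLipschitzField L f) (m : P2 d) (u : U) :
    LipschitzWith L fun x => f x m u :=
  LipschitzWith.of_dist_le_mul fun x y => by
    simpa [W2_self, dist_eq_norm] using hf x y m m u

lemma memLp (hf : IsLipschitzField L f) (m : P2 d) (u : U) {X : Ω → E d} (hX : MemLp X 2 μ) :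
    MemLp (fun ω => f (X ω) m u) 2 μ := by
  have hlip : LipschitzWith L fun x => f x m u - f 0 m u := by
    simpa using (hf.lipschitzWith m u).sub (LipschitzWith.const (f 0 m u))
  refine ((hlip.comp_memLp (sub_self _) hX).add (memLp_const (f 0 m u))).ae_eq ?_
  exact ae_of_all _ fun ω => sub_add_cancel _ _

/-- The velocity field lifted to random variables, `X ↦ f(X, law X, u)`. -/
noncomputable def lift (hf : IsLipschitzField L f) (X : Lp (E d) 2 μ) (u : U) : Lp (E d) 2 μ :=
  (hf.memLp (law X) u (Lp.memLp X)).toLp _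

variable (hf : IsLipschitzField L f)
include hf

lemma coeFn_lift (X : Lp (E d) 2 μ) (u : U) :
    hf.lift X u =ᵐ[μ] fun ω => f (X ω) (law X) u :=
  (hf.memLp (law X) u (Lp.memLp X)).coeFn_toLp

lemma lipschitzWith_lift (u : U) :
    LipschitzWith (2 * L) fun X : Lp (E d) 2 μ => hf.lift X u := by
  refine LipschitzWith.of_dist_le_mul fun X Y => ?_
  let V : Lp (E d) 2 μ := (hf.memLp (law X) u (Lp.memLp Y)).toLp _
  have hV : V =ᵐ[μ] fun ω => f (Y ω) (law X) u := MemLp.coeFn_toLp _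
  have hXV : dist (hf.lift X u) V ≤ L * dist X Y := by
    rw [dist_eq_norm, dist_eq_norm]
    refine Lp.norm_le_mul_norm_of_ae_le_mul ?_
    filter_upwards [Lp.coeFn_sub (hf.lift X u) V, Lp.coeFn_sub X Y, hf.coeFn_lift X u, hV]
      with ω hsub hXY hXω hVω
    rw [hsub, hXY, Pi.sub_apply, Pi.sub_apply, hXω, hVω]
    exact (hf.lipschitzWith (law X) u).norm_sub_le _ _
  have hVY : dist V (hf.lift Y u) ≤ L * dist X Y := by
    rw [dist_eq_norm, dist_eq_norm]
    refine Lp_norm_le_of_ae_norm_le (by positivity) ?_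
    filter_upwards [Lp.coeFn_sub V (hf.lift Y u), hf.coeFn_lift Y u, hV] with ω hsub hYω hVω
    rw [hsub, Pi.sub_apply, hYω, hVω]
    refine (hf _ _ _ _ _).trans ?_
    rw [sub_self, norm_zero, zero_add]
    gcongr
    exact W2_law_le X Y
  push_cast
  linarith [dist_triangle (hf.lift X u) V (hf.lift Y u)]

lemma hamiltonian_law {X p : Lp (E d) 2 μ} {s : E d → E d} (hs : IsConditionalField X p s) :
    hamiltonian f (law X) s = ⨅ u, inner ℝ p (hf.lift X u) :=
  iInf_congr fun u => hs.2 _ (hf.memLp (law X) u (law X).memLp_id)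

variable [TopologicalSpace U]

lemma continuous_lift_of_mem_simpleFunc (hcont : ∀ x m, Continuous (f x m)) {X : Lp (E d) 2 μ}
    (hX : X ∈ Lp.simpleFunc (E d) 2 μ) : Continuous (hf.lift X) := by
  set g := Lp.simpleFunc.toSimpleFunc ⟨X, hX⟩
  have hg : g =ᵐ[μ] X := Lp.simpleFunc.toSimpleFunc_eq_toFun ⟨X, hX⟩
  refine continuous_iff_continuousAt.2 fun u₀ => Metric.nhds_basis_closedBall.tendsto_right_iff.2
    fun ε hε => ?_
  have hev : ∀ᶠ u in 𝓝 u₀, ∀ x ∈ g.range, f x (law X) u ∈ Metric.closedBall (f x (law X) u₀) ε :=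
    (Filter.eventually_all_finset _).2 fun x _ =>
      (hcont x (law X)).tendsto u₀ (Metric.closedBall_mem_nhds _ hε)
  filter_upwards [hev] with u hu
  rw [mem_closedBall_iff_norm]
  refine Lp_norm_le_of_ae_norm_le hε.le ?_
  filter_upwards [Lp.coeFn_sub (hf.lift X u) (hf.lift X u₀), hf.coeFn_lift X u,
    hf.coeFn_lift X u₀, hg] with ω hsub hXu hXu₀ hgω
  rw [hsub, Pi.sub_apply, hXu, hXu₀, ← hgω]
  exact mem_closedBall_iff_norm.1 (hu _ (SimpleFunc.mem_range_self g ω))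

lemma continuous_lift (hcont : ∀ x m, Continuous (f x m)) :
    Continuous (Function.uncurry (hf.lift (μ := μ))) :=
  continuous_prod_of_dense_continuous_lipschitzWith _ (2 * L)
    (Lp.simpleFunc.dense ENNReal.ofNat_ne_top)
    (fun _ hX => hf.continuous_lift_of_mem_simpleFunc hcont hX) hf.lipschitzWith_lift

end IsLipschitzField

end LiftField

section Dirichlet

open scoped NNReal

variable {d : ℕ} {U Ω : Type*} [MeasurableSpace Ω] {μ : Measure Ω} [IsProbabilityMeasure μ]
  {f : E d → P2 d → U → E d} {L : ℝ≥0} {G : Set (P2 d)} {κ : DiffKind} {φ₁ φ₂ : P2 d → ℝ}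
  {X p : Lp (E d) 2 μ}

lemma mem_of_mem_closure_diff_frontier (hG : IsOpen G) {m : P2 d}
    (hm : m ∈ closure G \ frontier G) : m ∈ G := by
  rwa [closure_sdiff_frontier, hG.interior_eq] at hm

lemma preimage_law_closure_mem_nhds (hG : IsOpen G) (hX : law X ∈ G) :
    law ⁻¹' closure G ∈ 𝓝 X :=
  continuous_law.continuousAt.preimage_mem_nhds
    (mem_of_superset (hG.mem_nhds hX) subset_closure)

lemma IsViscositySupersolution.ineq_lift (h₁ : IsViscositySupersolution κ f G φ₁)
    (hG : IsOpen G) (hf : IsLipschitzField L f) (hX : law X ∈ G)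
    (hp : p ∈ proximalSubdifferential (fun Y => φ₁ (law Y)) (law ⁻¹' closure G) X) :
    (⨅ u, inner ℝ p (hf.lift X u)) + 1 - φ₁ (law X) ≤ 0 := by
  obtain ⟨s, hs⟩ := exists_isConditionalField X p
  rw [← hf.hamiltonian_law hs]
  exact h₁.ineq _ hX s (hs.mem_subdifferential (preimage_law_closure_mem_nhds hG hX) hp κ)

lemma IsViscositySubsolution.ineq_lift (h₂ : IsViscositySubsolution κ f G φ₂)
    (hG : IsOpen G) (hf : IsLipschitzField L f) (hX : law X ∈ G)
    (hp : p ∈ proximalSuperdifferential (fun Y => φ₂ (law Y)) (law ⁻¹' closure G) X) :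
    0 ≤ (⨅ u, inner ℝ p (hf.lift X u)) + 1 - φ₂ (law X) := by
  obtain ⟨s, hs⟩ := exists_isConditionalField X p
  rw [← hf.hamiltonian_law hs]
  exact h₂.ineq _ hX s (hs.mem_superdifferential (preimage_law_closure_mem_nhds hG hX) hp κ)

variable [TopologicalSpace U] [CompactSpace U] [Nonempty U]

theorem viscosity_comparison (hG : IsOpen G) (hf : IsLipschitzField L f)
    (hcont : ∀ x m, Continuous (f x m)) (h₁ : IsViscositySupersolution κ f G φ₁)
    (h₂ : IsViscositySubsolution κ f G φ₂) : ∀ m ∈ closure G, φ₂ m ≤ φ₁ m := by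
  intro m hm
  obtain ⟨C₁, hC₁⟩ := h₁.bounded
  obtain ⟨C₂, hC₂⟩ := h₂.bounded
  rw [← law_idLp m] at hm ⊢
  refine le_of_proximal_inequalities (hf.continuous_lift hcont) hf.lipschitzWith_lift
    (S := law ⁻¹' closure G) (B := law ⁻¹' frontier G) (M := C₂ + C₁)
    (φ₁ := fun X => φ₁ (law X)) (φ₂ := fun X => φ₂ (law X))
    (isClosed_closure.preimage continuous_law) (isClosed_frontier.preimage continuous_law)
    (h₁.lsc.comp continuous_law.continuousOn fun _ hX => hX)
    (h₂.usc.comp continuous_law.continuousOn fun _ hX => hX)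
    (fun X hX Y hY => ?_) (fun X hX => ?_) (fun X hX p hp => ?_) (fun X hX p hp => ?_) _ hm
  · linarith [neg_le_of_abs_le (hC₁ _ hX), le_of_abs_le (hC₂ _ hY)]
  · exact ((h₂.boundary _ hX.2).trans (h₁.boundary _ hX.2).symm).le
  · exact h₁.ineq_lift hG hf (mem_of_mem_closure_diff_frontier hG hX) hp
  · exact h₂.ineq_lift hG hf (mem_of_mem_closure_diff_frontier hG hX) hp

lemma IsViscositySolution.le (hG : IsOpen G) (hf : IsLipschitzField L f)
    (hcont : ∀ x m, Continuous (f x m)) {φ φ' : P2 d → ℝ} (h : IsViscositySolution κ f G φ)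
    (h' : IsViscositySolution κ f G φ') {m : P2 d} (hm : m ∈ closure G) : φ m ≤ φ' m := by
  by_cases hmG : m ∈ frontier G
  · rw [h.supersolution.boundary m hmG, h'.supersolution.boundary m hmG]
  · obtain ⟨φs, hsub, hlim⟩ := h.approx
    exact le_of_tendsto' (hlim m (mem_of_mem_closure_diff_frontier hG ⟨hm, hmG⟩)) fun k =>
      viscosity_comparison hG hf hcont h'.supersolution (hsub k) m hm

end Dirichlet

end WassersteinHJ

theorem mainTheorem2_general {d : ℕ} {U : Type*} [TopologicalSpace U] [CompactSpace U] [Nonempty U]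
    {f : E d → P2 d → U → E d} {L : NNReal} {G : Set (P2 d)} (hG : IsOpen G)
    (hf : IsLipschitzField L f) (hcont : ∀ x m, Continuous (f x m)) (κ : DiffKind) :
    (∀ φ₁ φ₂ : P2 d → ℝ, IsViscositySupersolution κ f G φ₁ → IsViscositySubsolution κ f G φ₂ →
      ∀ m ∈ closure G, φ₂ m ≤ φ₁ m) ∧
    (∀ φ φ' : P2 d → ℝ, IsViscositySolution κ f G φ → IsViscositySolution κ f G φ' →
      EqOn φ φ' (closure G)) :=
  ⟨fun _ _ => viscosity_comparison hG hf hcont, fun _ _ h h' _ hm =>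
    le_antisymm (h.le hG hf hcont h' hm) (h'.le hG hf hcont h hm)⟩

theorem mainTheorem2 {d : ℕ} {U : Type*} [MetricSpace U] [CompactSpace U] [Nonempty U]
    (f : E d → P2 d → U → E d)
    (hf_cont : Continuous (fun p : E d × P2 d × U => f p.1 p.2.1 p.2.2))
    (hf_lip : ∃ L : ℝ, 0 < L ∧ ∀ (x₁ x₂ : E d) (m₁ m₂ : P2 d) (u : U),
      ‖f x₁ m₁ u - f x₂ m₂ u‖ ≤ L * (‖x₁ - x₂‖ + W2 m₁ m₂))
    (M : Set (P2 d)) (hM : IsClosed M) (κ : DiffKind) :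
    (∀ φ₁ φ₂ : P2 d → ℝ,
      IsViscositySupersolution κ f Mᶜ φ₁ → IsViscositySubsolution κ f Mᶜ φ₂ →
      (∀ m ∈ closure Mᶜ, φ₁ m ∈ Set.Icc (0 : ℝ) 1) →
      (∀ m ∈ closure Mᶜ, φ₂ m ∈ Set.Icc (0 : ℝ) 1) →
      ∀ m ∈ closure Mᶜ, φ₂ m ≤ φ₁ m) ∧
    (∀ φ φ' : P2 d → ℝ,
      IsViscositySolution κ f Mᶜ φ → IsViscositySolution κ f Mᶜ φ' →
      Set.EqOn φ φ' (closure Mᶜ)) := by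
  obtain ⟨L, hL, hlip⟩ := hf_lip
  obtain ⟨hcomp, huniq⟩ := mainTheorem2_general hM.isOpen_compl (L := ⟨L, hL.le⟩) hlip
    (fun x m => hf_cont.comp (by fun_prop : Continuous fun u : U => (x, m, u))) κ
  exact ⟨fun φ₁ φ₂ h₁ h₂ _ _ => hcomp φ₁ φ₂ h₁ h₂, huniq⟩
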